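/- **Conventions.** For an $n$-edge-coloured graph (colours $0,\dots,n-1$, semi-edges allowed) in which every vertex ("flag") lies on exactly one edge of each colour, let $r_i$ be the involution of the flags given by the edges of colour $i$. The graph is an *$n$-premaniplex* if it is connected and $(r_ir_j)^2=1$ whenever $|i-j|>1$; an *$n$-maniplex* if moreover it is finite and simple; an *$n$-polytope* if moreover any two flags joined by a path with colours in $[0,m]$ and by a path with colours in $[l,n-1]$ are joined by a path with colours in $[l,m]$. A polyhedron is a 3-polytope. The $i$-faces are the connected components after deleting the edges of colour $i$ (vertices: $i=0$; facets: $i=n-1$). The automorphism group (colour-preserving automorphisms) acts on the right. The symmetry type graph is the quotient by the automorphism group. A maniplex is chiral if it has exactly two flag orbits and adjacent flags always lie in different orbits. A Petrie polygon is an orbit of flags under $r_{n-1}\cdots r_1r_0$ ($r_0$ applied first); it is simple if any two different flags in it lie in different vertices. In a voltage graph with voltages $\xi(d)\in\Gamma$, $\xi(d^{-1})=\xi(d)^{-1}$, the voltage of a path $d_1\cdots d_m$ is $\xi(d_m)\cdots\xi(d_1)$; the derived graph $\mathcal X^\xi$ has vertex set $V(\mathcal X)\times\Gamma$ and, for each dart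 $d$ from $x$ to $y$ and each $\gamma\in\Gamma$, a dart of the same colour from $(x,\gamma)$ to $(y,\xi(d)\gamma)$. A voltage graph $(\mathcal X,\Gamma,\xi)$ is a *voltage premaniplex* if $\mathcal X$ is a premaniplex, some spanning tree has trivial voltages and the remaining voltages generate $\Gamma$, voltages of semi-edges have order 2, distinct parallel darts have distinct voltages, and for $|i-j|>1$ every alternating path of length 4 with colours $i,j$ has trivial voltage. **Theorem.** Let $k\ge 2$, let $\mathcal P$ be a chiral $(2k+1)$-polytope all of whose Petrie polygons are simple, and let $\Phi$ be a flag of $\mathcal P$. Then for each $i\in\{1,\dots,2k\}$ there is a unique automorphism $\tau_i$ of $\mathcal P$ with $\Phi\tau_i=r_ir_0\Phi$, and $\tau_1,\dots,\tau_{2k}$ generate the automorphism group $\Gamma$ of $\mathcal P$. Let $\mathcal X$ be the following 3-premaniplex (family 2 on a $4k$-gon): its flags are the left flag $L_i$ and the right flag $R_i$ of the edge $e_i$, $i\in\mathbb Z/4k$; colour 0 joins $L_i$ with $R_i$, colour 1 joins $R_i$ with $L_{i+1}$, and colour 2 joins $L_i$ with $R_{i+2k}$. Let $\xi$ assign the trivial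 voltage to all darts of colours 0 and 1, and, for $0\le i<2k$, the voltage $\tau_{i+1}$ to both darts of colour 2 starting at (a flag of) $e_i$, and $\tau_{i+1}^{-1}$ to both darts of colour 2 starting at $e_{2k+i}$. Then $(\mathcal X,\Gamma,\xi)$ is a voltage premaniplex, and the derived graph $\mathcal X^\xi$ is a polyhedron whose symmetry type graph is isomorphic to $\mathcal X$. In particular $\mathcal X^\xi$ is vertex-transitive and facet-transitive, and the stabilizer of each facet in its automorphism group is trivial. -/

import Mathlib

universe u v w

/-- A graph with semi-edges allowed, with edges coloured by `{0, …, n-1}`, such that every vertex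
(called a flag) is incident to exactly one edge of each colour.  The dart of colour `i` starting at
`x` is given by the pair `(i, x)`; its final vertex is `adj i x`, its inverse is the dart
`(i, adj i x)`, and it is a semi-edge iff `adj i x = x`. -/
structure FlagGraph (n : ℕ) where
  /-- the vertices of the graph -/
  Flag : Type u
  /-- the `i`-adjacent flag of a flag -/
  adj : Fin n → Flag → Flag
  adj_adj : ∀ i x, adj i (adj i x) = x

namespace FlagGraph

variable {n : ℕ}

/-- The permutation `r_i` mapping each flag to its `i`-adjacent flag. -/
def r (G : FlagGraph.{u} n) (i : Fin n) : Equiv.Perm G.Flag :=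
  Function.Involutive.toPerm (G.adj i) (G.adj_adj i)

/-- There is a path from `x` to `y` using only colours in `S`. -/
def Joined (G : FlagGraph.{u} n) (S : Set (Fin n)) (x y : G.Flag) : Prop :=
  Relation.ReflTransGen (fun a b => ∃ i ∈ S, b = G.adj i a) x y

/-- Premaniplexes of rank `n`: connected, and alternating paths of length 4 with colours `i`, `j`
such that `|i - j| > 1` are closed. -/
structure IsPremaniplex (G : FlagGraph.{u} n) : Prop where
  nonempty : Nonempty G.Flag
  connected : ∀ x y : G.Flag, G.Joined Set.univ x y
  closed : ∀ i j : Fin n, 1 < |((i : ℕ) : ℤ) - ((j : ℕ) : ℤ)| →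
    ∀ x : G.Flag, G.adj j (G.adj i (G.adj j (G.adj i x))) = x

/-- Maniplexes of rank `n`: finite premaniplexes that are simple graphs
(no semi-edges and no parallel edges). -/
structure IsManiplex (G : FlagGraph.{u} n) : Prop extends G.IsPremaniplex where
  finite : Finite G.Flag
  no_semiedge : ∀ (i : Fin n) (x : G.Flag), G.adj i x ≠ x
  no_parallel : ∀ (i j : Fin n) (x : G.Flag), i ≠ j → G.adj i x ≠ G.adj j x

/-- Abstract polytopes of rank `n`: maniplexes with the path intersection property. -/
structure IsPolytope (G : FlagGraph.{u} n) : Prop extends G.IsManiplex where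
  path_intersection : ∀ (k m : Fin n) (x y : G.Flag),
    G.Joined {i | i ≤ m} x y → G.Joined {i | k ≤ i} x y → G.Joined {i | k ≤ i ∧ i ≤ m} x y

/-- Colour preserving isomorphisms. -/
structure Iso (G : FlagGraph.{u} n) (H : FlagGraph.{v} n) where
  toEquiv : G.Flag ≃ H.Flag
  map_adj : ∀ i x, toEquiv (G.adj i x) = H.adj i (toEquiv x)

/-- The automorphism group, as a group of permutations of the flags (product = composition of
functions). -/
def Aut (G : FlagGraph.{u} n) : Subgroup (Equiv.Perm G.Flag) where
  carrier := {σ | ∀ i x, σ (G.adj i x) = G.adj i (σ x)}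
  one_mem' := fun _ _ => rfl
  mul_mem' := by
    intro a b ha hb i x
    change a (b (G.adj i x)) = G.adj i (a (b x))
    rw [hb, ha]
  inv_mem' := by
    intro a ha i x
    change a.symm (G.adj i x) = G.adj i (a.symm x)
    rw [Equiv.symm_apply_eq, ha, Equiv.apply_symm_apply]

/-- The automorphism group acting on the right of the flags: in `σ * τ` one applies `σ` first. -/
abbrev RightAut (G : FlagGraph.{u} n) : Type u := (G.Aut)ᵐᵒᵖ

/-- The image `x γ` of a flag `x` under an automorphism `γ` acting on the right. -/
def act {G : FlagGraph.{u} n} (x : G.Flag) (γ : G.RightAut) : G.Flag :=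
  (γ.unop : Equiv.Perm G.Flag) x

theorem act_mul {G : FlagGraph.{u} n} (x : G.Flag) (γ δ : G.RightAut) :
    act x (γ * δ) = act (act x γ) δ := rfl

/-- The `i`-face containing the flag `x`: its connected component after removing colour `i`. -/
def face (G : FlagGraph.{u} n) (i : Fin n) (x : G.Flag) : Set G.Flag :=
  {y | G.Joined {j | j ≠ i} x y}

/-- The automorphism group is transitive on `i`-faces. -/
def IsFaceTransitive (G : FlagGraph.{u} n) (i : Fin n) : Prop :=
  ∀ x y : G.Flag, ∃ σ ∈ G.Aut, σ '' G.face i x = G.face i y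

/-- The stabilizer, in the automorphism group, of each `i`-face is trivial. -/
def HasTrivialFaceStabilizer (G : FlagGraph.{u} n) (i : Fin n) : Prop :=
  ∀ x : G.Flag, ∀ σ ∈ G.Aut, σ '' G.face i x = G.face i x → σ = 1

/-- The symmetry type graph: the quotient by the automorphism group. -/
def symmetryTypeGraph (G : FlagGraph.{u} n) : FlagGraph.{u} n where
  Flag := MulAction.orbitRel.Quotient G.Aut G.Flag
  adj i := Quotient.map (G.adj i) (by
    rintro a b ⟨σ, hσ⟩
    refine ⟨σ, ?_⟩
    rw [← hσ]
    exact σ.2 i b)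
  adj_adj i x := by
    induction x using Quotient.inductionOn with
    | h a => simp only [Quotient.map_mk, G.adj_adj]

/-- Chirality: two flag orbits, and adjacent flags lie in different orbits. -/
def IsChiral (G : FlagGraph.{u} n) : Prop :=
  Nat.card (MulAction.orbitRel.Quotient G.Aut G.Flag) = 2 ∧
    ∀ (i : Fin n) (x : G.Flag), ¬ ∃ σ ∈ G.Aut, σ x = G.adj i x

/-- The monodromy `r_{n-1} ⋯ r_1 r_0` (where `r_0` is applied first). -/
def petrieMonodromy (G : FlagGraph.{u} n) : Equiv.Perm G.Flag :=
  ((List.finRange n).reverse.map G.r).prod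

/-- The Petrie polygon containing a flag. -/
def petriePolygon (G : FlagGraph.{u} n) (x : G.Flag) : Set G.Flag :=
  {y | ∃ m : ℤ, (G.petrieMonodromy ^ m) x = y}

/-- All Petrie polygons are simple: different flags of a Petrie polygon have different vertices. -/
def HasSimplePetriePolygons (G : FlagGraph.{u} (n + 1)) : Prop :=
  ∀ x : G.Flag, ∀ y ∈ G.petriePolygon x, ∀ z ∈ G.petriePolygon x, y ≠ z →
    G.face 0 y ≠ G.face 0 z

/-- `τ j` is the automorphism usually written `τ_{j+1}`: the one with
`x τ_{j+1} = r_{j+1} r_0 x`, where `x` is the base flag. -/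
def IsDistinguishedFamily (G : FlagGraph.{u} (n + 1)) (x : G.Flag) (τ : Fin n → G.RightAut) :
    Prop :=
  ∀ j : Fin n, act x (τ j) = G.r j.succ (G.r 0 x)

/-- Voltage assignments: `volt i x` is the voltage of the dart of colour `i` starting at `x`. -/
structure VoltageAssignment (X : FlagGraph.{u} n) (Γ : Type v) [Group Γ] where
  volt : Fin n → X.Flag → Γ
  volt_adj : ∀ i x, volt i (X.adj i x) = (volt i x)⁻¹

namespace VoltageAssignment

variable {X : FlagGraph.{u} n} {Γ : Type v} [Group Γ]

/-- The derived graph: the dart of colour `i` at `x` with voltage `ξ` gives, for each `γ`, a dart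
of colour `i` from `(x, γ)` to `(adj i x, ξ γ)`. -/
def derived (ξ : VoltageAssignment X Γ) : FlagGraph.{max u v} n where
  Flag := X.Flag × Γ
  adj i p := (X.adj i p.1, ξ.volt i p.1 * p.2)
  adj_adj i p := by
    rw [ξ.volt_adj, X.adj_adj, inv_mul_cancel_left]

/-- Voltage premaniplexes.  The first two voltage conditions say that there is a spanning tree
all of whose darts have trivial voltage, and that the voltages (equivalently, those of the darts
outside the tree) generate the group. -/
structure IsVoltagePremaniplex (ξ : VoltageAssignment X Γ) : Prop where
  premaniplex : X.IsPremaniplex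
  spanning_tree : ∃ T : SimpleGraph X.Flag, T.IsTree ∧
    ∀ x y, T.Adj x y → ∃ i, X.adj i x = y ∧ ξ.volt i x = 1
  generate : Subgroup.closure {γ : Γ | ∃ i x, γ = ξ.volt i x} = ⊤
  semiedge : ∀ i x, X.adj i x = x → orderOf (ξ.volt i x) = 2
  parallel : ∀ i j x, i ≠ j → X.adj i x = X.adj j x → ξ.volt i x ≠ ξ.volt j x
  closed : ∀ i j : Fin n, 1 < |((i : ℕ) : ℤ) - ((j : ℕ) : ℤ)| → ∀ x : X.Flag,
    ξ.volt j (X.adj i (X.adj j (X.adj i x))) * ξ.volt i (X.adj j (X.adj i x)) *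
      ξ.volt j (X.adj i x) * ξ.volt i x = 1

end VoltageAssignment

/-- The premaniplex of family 2 on a `4k`-gon.  The flags `(i, false)` and `(i, true)` are the left
and the right flag of the edge `e_i` of the `4k`-gon, `i` modulo `4k`.  Colours 0 and 1 are those of
the `4k`-gon: the right flag of `e_i` is 0-adjacent to the left flag of `e_i` and 1-adjacent to the
left flag of `e_{i+1}`.  Colour 2 joins each flag to the 0-adjacent flag of its opposite flag. -/
def family2 (k : ℕ) : FlagGraph.{0} 3 where
  Flag := ZMod (4 * k) × Bool
  adj c p := match c, p with
    | 0, (i, s) => (i, !s)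
    | 1, (i, false) => (i - 1, true)
    | 1, (i, true) => (i + 1, false)
    | 2, (i, s) => (i + ((2 * k : ℕ) : ZMod (4 * k)), !s)
  adj_adj c p := by
    obtain ⟨i, s⟩ := p
    have h : ((2 * k : ℕ) : ZMod (4 * k)) + ((2 * k : ℕ) : ZMod (4 * k)) = 0 := by
      rw [← Nat.cast_add, show 2 * k + 2 * k = 4 * k by ring, ZMod.natCast_self]
    fin_cases c <;> cases s <;> simp [add_assoc, -Nat.cast_mul, h]

/-- The voltage of the darts of colour 2 starting at the edge `e_i`: it is `τ_{i+1}` (that is,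
`τ i` with indices starting at 0) for `0 ≤ i < 2k`, and `τ_{i-2k+1}⁻¹` for `2k ≤ i < 4k`. -/
def edgeVoltage {Γ : Type v} [Group Γ] (k : ℕ) (hk : 0 < k) (τ : Fin (2 * k) → Γ)
    (i : ZMod (4 * k)) : Γ :=
  if h : i.val < 2 * k then τ ⟨i.val, h⟩
  else (τ ⟨i.val - 2 * k, by
    have : NeZero (4 * k) := ⟨by omega⟩
    have := ZMod.val_lt i
    omega⟩)⁻¹

theorem edgeVoltage_opposite {Γ : Type v} [Group Γ] (k : ℕ) (hk : 0 < k) (τ : Fin (2 * k) → Γ)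
    (i : ZMod (4 * k)) :
    edgeVoltage k hk τ (i + ((2 * k : ℕ) : ZMod (4 * k))) = (edgeVoltage k hk τ i)⁻¹ := by
  have : NeZero (4 * k) := ⟨by omega⟩
  have hi := ZMod.val_lt i
  have h2 : ((2 * k : ℕ) : ZMod (4 * k)).val = 2 * k := ZMod.val_natCast_of_lt (by omega)
  have hv : (i + ((2 * k : ℕ) : ZMod (4 * k))).val = (i.val + 2 * k) % (4 * k) := by
    rw [ZMod.val_add, h2]
  unfold edgeVoltage
  by_cases h : i.val < 2 * k
  · rw [Nat.mod_eq_of_lt (by omega)] at hv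
    rw [dif_neg (by omega), dif_pos h]
    congr 3
    omega
  · have hm : (i.val + 2 * k) % (4 * k) = i.val - 2 * k := by
      rw [show i.val + 2 * k = (i.val - 2 * k) + 4 * k by omega, Nat.add_mod_right,
        Nat.mod_eq_of_lt (by omega)]
    rw [hm] at hv
    rw [dif_pos (by omega), dif_neg h, inv_inv]
    congr 2

/-- The voltage assignment on the family 2 premaniplex: darts of colours 0 and 1 have trivial
voltage, and both darts of colour 2 starting at `e_i` have voltage `edgeVoltage k hk τ i`. -/
def family2Voltage {Γ : Type v} [Group Γ] (k : ℕ) (hk : 0 < k) (τ : Fin (2 * k) → Γ) :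
    VoltageAssignment (family2 k) Γ where
  volt c p := if c = 2 then edgeVoltage k hk τ p.1 else 1
  volt_adj c p := by
    obtain ⟨i, s⟩ := p
    by_cases hc : c = 2
    · subst hc
      simp only [if_true]
      exact edgeVoltage_opposite k hk τ i
    · simp [hc]

end FlagGraph

/-! The facets of the derived graph are copies of the 4k-gon, one for each element of Γ. Write V_i
for the colour-2 voltage at e_i. Circling a vertex leads from e_i across to e_{i+2k} and on to
e_{i+2k+1}, so the facets met successively are T_t γ, where T_t = V_{(t-1)(2k+1)} ⋯ V_0 is `turn`.
Modulo 4k, the position t(2k+1) with t = 2kq + c is c or its opposite, by the parity of q + c; hence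
the factors run cyclically through τ_1^{±1}, …, τ_{2k}^{±1}.

Left multiplication by τ_j changes Φγ into r_j r_0 Φγ, and by its inverse into r_0 r_j Φγ. Since r_0
commutes with r_j for j ≥ 2, the flags ΦT_t follow the Petrie walk r_{2k} ⋯ r_1 r_0 up to r_0
(`IsDistinguishedFamily.act_turn`). The rank being odd, a full Petrie step exchanges the two flag
orbits, which matches the alternating exponent of τ_1. Simplicity of the Petrie polygons then forces
s ≡ t mod 4k whenever T_s = T_t (`IsDistinguishedFamily.turn_injective`), so a facet and a vertex
share at most two flags (`facet_inter_vertex`). This is the path intersection property.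

An automorphism of the derived graph acts on every facet by one and the same dihedral symmetry e of
the 4k-gon, because these symmetries commute with colour 2 (`family2_dihedral_adj`). After
normalization it induces an injective endomorphism of Γ with V_i ↦ V_{e(i)}. Only V_0 and V_{2k}
have nontrivial square, so e preserves {0, 2k}. The half turn would invert every τ_j, contradicting
chirality (`not_reflexible`). The two reflections would carry τ_1τ_2 to τ_1^{±1}τ_{2k}; but
(τ_1^{±1}τ_{2k})² = 1, whereas (τ_1τ_2)² ≠ 1, since r_1 and r_2 commute in no chiral polytope
(`IsChiral.step_one_two_ne`). Hence e is trivial, automorphisms preserve fibres, and the symmetry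
type graph is the base graph. -/

namespace FlagGraph

/-! ### Paths, rigidity of colour-preserving maps, and partial Petrie walks -/

section Basic

variable {n : ℕ} {G : FlagGraph.{u} n}

theorem joined_adj {S : Set (Fin n)} {i : Fin n} (hi : i ∈ S) (x : G.Flag) :
    G.Joined S x (G.adj i x) :=
  Relation.ReflTransGen.single ⟨i, hi, rfl⟩

theorem Joined.trans {S : Set (Fin n)} {x y z : G.Flag} (h₁ : G.Joined S x y)
    (h₂ : G.Joined S y z) : G.Joined S x z :=
  Relation.ReflTransGen.trans h₁ h₂

theorem Joined.mono {S T : Set (Fin n)} (hST : S ⊆ T) {x y : G.Flag} (h : G.Joined S x y) :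
    G.Joined T x y :=
  Relation.ReflTransGen.mono (p := fun a b => ∃ i ∈ T, b = G.adj i a)
    (fun _ _ ⟨i, hi, hb⟩ => ⟨i, hST hi, hb⟩) _ _ h

theorem Joined.symm {S : Set (Fin n)} {x y : G.Flag} (h : G.Joined S x y) : G.Joined S y x := by
  induction h with
  | refl => exact Relation.ReflTransGen.refl
  | @tail b c _ hbc ih =>
    obtain ⟨i, hi, rfl⟩ := hbc
    refine Joined.trans ?_ ih
    have := joined_adj hi (G.adj i b)
    rwa [G.adj_adj] at this

/-- A property that is preserved by the colours of a path holds at its end. -/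
theorem Joined.induction {S : Set (Fin n)} {x y : G.Flag} (h : G.Joined S x y)
    {p : G.Flag → Prop} (hx : p x) (hp : ∀ i ∈ S, ∀ z, p z → p (G.adj i z)) : p y := by
  induction h with
  | refl => exact hx
  | tail _ hbc ih =>
    obtain ⟨i, hi, rfl⟩ := hbc
    exact hp i hi _ ih

theorem Joined.eq_of_isEmpty {S : Set (Fin n)} (hS : ∀ i, i ∉ S) {x y : G.Flag}
    (h : G.Joined S x y) : y = x :=
  h.induction (p := fun z => z = x) rfl fun i hi => absurd hi (hS i)

theorem Joined.eq_or_eq_adj {S : Set (Fin n)} {i : Fin n} (hS : ∀ j ∈ S, j = i) {x y : G.Flag}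
    (h : G.Joined S x y) : y = x ∨ y = G.adj i x := by
  refine h.induction (p := fun z => z = x ∨ z = G.adj i x) (Or.inl rfl) ?_
  rintro j hj z (rfl | rfl) <;> rw [hS j hj]
  · exact Or.inr rfl
  · exact Or.inl (G.adj_adj i x)

theorem face_eq_face_iff {i : Fin n} {x y : G.Flag} :
    G.face i x = G.face i y ↔ G.Joined {j | j ≠ i} x y := by
  constructor
  · intro h
    have hy : y ∈ G.face i y := Relation.ReflTransGen.refl
    rwa [← h] at hy
  · intro h
    ext z
    exact ⟨fun hz => h.symm.trans hz, fun hz => h.trans hz⟩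

/-- Rigidity: connectedness propagates agreement at one flag along the colours. Freeness of the
automorphism action is the special case with the identity. -/
theorem IsPremaniplex.eq_of_adj_eq (hG : G.IsPremaniplex) {m : ℕ} {H : FlagGraph.{v} m}
    (c : Fin n → Fin m) {f g : G.Flag → H.Flag}
    (hf : ∀ i x, f (G.adj i x) = H.adj (c i) (f x))
    (hg : ∀ i x, g (G.adj i x) = H.adj (c i) (g x)) {x : G.Flag} (hx : f x = g x) : f = g := by
  funext y
  refine (hG.connected x y).induction (p := fun z => f z = g z) hx ?_
  intro i _ z hz
  rw [hf, hg, hz]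

theorem IsPremaniplex.aut_eq_one (hG : G.IsPremaniplex) {σ : Equiv.Perm G.Flag}
    (hσ : σ ∈ G.Aut) {x : G.Flag} (hx : σ x = x) : σ = 1 :=
  Equiv.ext fun y =>
    congrFun (hG.eq_of_adj_eq id (f := σ) (g := id) hσ (fun _ _ => rfl) hx) y

theorem IsPremaniplex.surjective_of_adj (hG : G.IsPremaniplex) {f : G.Flag → G.Flag}
    (hf : ∀ i x, f (G.adj i x) = G.adj i (f x)) : Function.Surjective f := by
  obtain ⟨x⟩ := hG.nonempty
  intro y
  refine (hG.connected (f x) y).induction (p := fun z => ∃ a, f a = z) ⟨x, rfl⟩ ?_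
  rintro i _ _ ⟨a, rfl⟩
  exact ⟨G.adj i a, hf i a⟩

/-- In a finite premaniplex, a map commuting with all colours is an automorphism. -/
theorem IsPremaniplex.exists_aut (hG : G.IsPremaniplex) [Finite G.Flag] {f : G.Flag → G.Flag}
    (hf : ∀ i x, f (G.adj i x) = G.adj i (f x)) : ∃ σ ∈ G.Aut, ∀ x, σ x = f x := by
  have hb : Function.Bijective f :=
    Finite.surjective_iff_bijective.1 (hG.surjective_of_adj hf)
  exact ⟨Equiv.ofBijective f hb, hf, fun _ => rfl⟩

theorem act_adj (i : Fin n) (x : G.Flag) (γ : G.RightAut) :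
    act (G.adj i x) γ = G.adj i (act x γ) :=
  γ.unop.2 i x

theorem act_one (x : G.Flag) : act x (1 : G.RightAut) = x := rfl

theorem IsPremaniplex.act_injective (hG : G.IsPremaniplex) (x : G.Flag) :
    Function.Injective (act x : G.RightAut → G.Flag) := by
  intro γ δ h
  have h1 : act (act x γ) γ⁻¹ = x := by rw [← act_mul, mul_inv_cancel, act_one]
  have h2 : act x (δ * γ⁻¹) = x := by rw [act_mul, ← h, h1]
  have h3 : ((δ * γ⁻¹).unop : Equiv.Perm G.Flag) = 1 := hG.aut_eq_one (δ * γ⁻¹).unop.2 h2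
  have h4 : δ * γ⁻¹ = 1 := MulOpposite.unop_injective (Subtype.ext h3)
  exact (mul_inv_eq_one.1 h4).symm

theorem IsPremaniplex.finite_rightAut (hG : G.IsPremaniplex) [Finite G.Flag] :
    Finite G.RightAut := by
  obtain ⟨x⟩ := hG.nonempty
  exact Finite.of_injective _ (hG.act_injective x)

/-- The permutation `r_c`, with the colour `c` a natural number (trivial if `c ≥ n`). -/
def step (G : FlagGraph.{u} n) (c : ℕ) : Equiv.Perm G.Flag :=
  if h : c < n then G.r ⟨c, h⟩ else 1

theorem step_of_lt {c : ℕ} (h : c < n) (x : G.Flag) : G.step c x = G.adj ⟨c, h⟩ x := by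
  rw [step, dif_pos h]; rfl

theorem step_val (i : Fin n) (x : G.Flag) : G.step i x = G.adj i x := step_of_lt i.2 x

@[simp]
theorem step_step (c : ℕ) (x : G.Flag) : G.step c (G.step c x) = x := by
  by_cases h : c < n
  · rw [step_of_lt h, step_of_lt h, G.adj_adj]
  · simp [step, h]

theorem act_step (c : ℕ) (x : G.Flag) (γ : G.RightAut) :
    act (G.step c x) γ = G.step c (act x γ) := by
  by_cases h : c < n
  · rw [step_of_lt h, step_of_lt h, act_adj]
  · simp [step, h]

theorem IsPremaniplex.step_comm (hG : G.IsPremaniplex) {i j : ℕ} (hij : i + 1 < j) (x : G.Flag) :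
    G.step i (G.step j x) = G.step j (G.step i x) := by
  by_cases hj : j < n
  · have hi : i < n := by omega
    rw [step_of_lt hi, step_of_lt hj, step_of_lt hj, step_of_lt hi]
    have h := hG.closed ⟨i, hi⟩ ⟨j, hj⟩ (by simp only; rw [lt_abs]; omega) x
    rw [← h, G.adj_adj, G.adj_adj, h]
  · simp [step, hj]

/-- The product `r_{c-1} ⋯ r_1 r_0`, where `r_0` is applied first. -/
def walk (G : FlagGraph.{u} n) : ℕ → Equiv.Perm G.Flag
  | 0 => 1
  | c + 1 => G.step c * G.walk c

theorem walk_succ (c : ℕ) (x : G.Flag) : G.walk (c + 1) x = G.step c (G.walk c x) := rfl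

theorem petrieMonodromy_eq_walk : G.petrieMonodromy = G.walk n := by
  have h : ∀ c, ((List.range c).reverse.map G.step).prod = G.walk c := by
    intro c
    induction c with
    | zero => rfl
    | succ c ih =>
      rw [List.range_succ, List.reverse_append, List.map_append, List.prod_append, ih]
      simp [walk]
  rw [← h, petrieMonodromy, ← List.map_coe_finRange_eq_range, ← List.map_reverse, List.map_map]
  congr 1
  refine List.map_congr_left fun i _ => Equiv.ext fun x => (step_val i x).symm

theorem joined_walk {a b : ℕ} (hab : a ≤ b) (hb : b ≤ n) (x : G.Flag) :
    G.Joined {i | a ≤ (i : ℕ) ∧ (i : ℕ) < b} (G.walk a x) (G.walk b x) := by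
  induction b, hab using Nat.le_induction with
  | base => exact Relation.ReflTransGen.refl
  | succ b hab ih =>
    refine ((ih (by omega)).mono fun i hi => ?_).trans ?_
    · exact ⟨hi.1, hi.2.trans (Nat.lt_succ_self b)⟩
    rw [walk_succ, step_of_lt (by omega)]
    refine joined_adj ?_ _
    exact ⟨hab, Nat.lt_succ_self b⟩

/-- The factors r_j with j ≥ 2 commute with r_0, so the walk can be continued on the other side of a
0-edge. -/
theorem IsPremaniplex.joined_step_zero_walk (hG : G.IsPremaniplex) {a b : ℕ} (ha : 2 ≤ a)
    (hab : a ≤ b) (hb : b ≤ n) (x : G.Flag) :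
    G.Joined {i | a ≤ (i : ℕ)} (G.step 0 (G.walk a x)) (G.step 0 (G.walk b x)) := by
  induction b, hab using Nat.le_induction with
  | base => exact Relation.ReflTransGen.refl
  | succ b hab ih =>
    refine (ih (by omega)).trans ?_
    rw [walk_succ, hG.step_comm (by omega), step_of_lt (c := b) (by omega)]
    exact joined_adj hab _

/-- Partial products of different lengths of `r_{n-1} ⋯ r_0` move a flag to different flags. -/
theorem IsPolytope.walk_ne (hG : G.IsPolytope) {a b : ℕ} (hab : a < b) (hb : b ≤ n) (x : G.Flag) :
    G.walk a x ≠ G.walk b x := by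
  intro h
  obtain ⟨b, rfl⟩ := Nat.exists_eq_add_of_lt hab
  have hbn : a + b < n := by omega
  rw [walk_succ, step_of_lt hbn] at h
  have hj : G.Joined {i | (⟨a + b, hbn⟩ : Fin n) ≤ i} (G.walk a x) (G.walk (a + b) x) := by
    rw [h]
    have := joined_adj (S := {i | (⟨a + b, hbn⟩ : Fin n) ≤ i}) (i := ⟨a + b, hbn⟩) (by simp)
      (G.walk (a + b) x)
    exact this.symm
  have hw : G.walk (a + b) x = G.walk a x := by
    rcases Nat.eq_zero_or_pos b with rfl | hb0
    · rfl
    -- The walk uses only colours from a to a + b - 1, and the other path only colours from a + b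
    -- on; no colour is common, so the two flags coincide.
    · refine (hG.path_intersection ⟨a + b, hbn⟩ ⟨a + b - 1, by omega⟩ _ _ ?_ hj).eq_of_isEmpty ?_
      · refine (joined_walk (by omega) hbn.le x).mono fun i hi => ?_
        have := hi.2
        simp only [Set.mem_ofPred_eq, Fin.le_def]
        omega
      · intro i hi
        simp only [Set.mem_ofPred_eq, Fin.le_def] at hi
        omega
  rw [hw] at h
  exact hG.no_semiedge _ _ h.symm

end Basic

/-! ### The two flag orbits of a chiral polytope, and noncommuting colours -/

section Chiral

variable {n : ℕ} {P : FlagGraph.{u} n}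

/-- The flags in the orbit of `Φ` under the automorphism group. -/
def IsWhite (Φ x : P.Flag) : Prop := ∃ γ : P.RightAut, act Φ γ = x

theorem isWhite_iff_orbit {Φ x : P.Flag} :
    IsWhite Φ x ↔ (Quotient.mk _ x : MulAction.orbitRel.Quotient P.Aut P.Flag) =
      Quotient.mk _ Φ := by
  rw [Quotient.eq]
  exact ⟨fun ⟨γ, h⟩ => ⟨γ.unop, h⟩, fun ⟨σ, h⟩ => ⟨MulOpposite.op σ, h⟩⟩

theorem isWhite_self (Φ : P.Flag) : IsWhite Φ Φ := ⟨1, rfl⟩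

theorem IsChiral.isWhite_adj (hc : P.IsChiral) (Φ x : P.Flag) (i : Fin n) :
    IsWhite Φ (P.adj i x) ↔ ¬ IsWhite Φ x := by
  have hne : ∀ y : P.Flag, (Quotient.mk _ (P.adj i y) : MulAction.orbitRel.Quotient P.Aut P.Flag) ≠
      Quotient.mk _ y := by
    intro y h
    rw [Quotient.eq] at h
    obtain ⟨σ, hσ⟩ := h
    exact hc.2 i y ⟨σ, σ.2, hσ⟩
  rw [isWhite_iff_orbit, isWhite_iff_orbit]
  obtain ⟨a, b, hab, huniv⟩ := Nat.card_eq_two_iff.1 hc.1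
  have hall : ∀ q : MulAction.orbitRel.Quotient P.Aut P.Flag, q = a ∨ q = b := by
    intro q
    have : q ∈ ({a, b} : Set _) := huniv ▸ Set.mem_univ q
    simpa using this
  have h1 := hne x
  rcases hall (Quotient.mk _ x) with h | h <;> rcases hall (Quotient.mk _ (P.adj i x)) with h' | h' <;>
    rcases hall (Quotient.mk _ Φ) with h'' | h'' <;> rw [h, h'] at h1 <;> rw [h, h', h''] <;>
    simp_all [eq_comm]

theorem IsChiral.isWhite_step (hc : P.IsChiral) (Φ x : P.Flag) {c : ℕ} (h : c < n) :
    IsWhite Φ (P.step c x) ↔ ¬ IsWhite Φ x := by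
  rw [step_of_lt h]
  exact hc.isWhite_adj Φ x _

theorem IsChiral.isWhite_walk (hc : P.IsChiral) (Φ x : P.Flag) {c : ℕ} (h : c ≤ n) :
    IsWhite Φ (P.walk c x) ↔ (IsWhite Φ x ↔ Even c) := by
  induction c with
  | zero => simp [walk]
  | succ c ih =>
    rw [walk_succ, hc.isWhite_step Φ _ (by omega), ih (by omega), Nat.even_add_one]
    tauto

/-- If `r_i` and `r_j` commute at the base flag, they commute everywhere. -/
theorem IsChiral.step_comm_of_base (hc : P.IsChiral) (Φ : P.Flag) {i j : ℕ} (hi : i < n)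
    (h : P.step i (P.step j Φ) = P.step j (P.step i Φ)) (x : P.Flag) :
    P.step i (P.step j x) = P.step j (P.step i x) := by
  have hw : ∀ y, IsWhite Φ y → P.step i (P.step j y) = P.step j (P.step i y) := by
    rintro _ ⟨γ, rfl⟩
    simp only [← act_step, h]
  by_cases hx : IsWhite Φ x
  · exact hw x hx
  -- The flag r_i x lies in the base orbit; commutation there, after cancelling r_i, gives
  -- commutation at x.
  · have h1 := hw (P.step i x) ((hc.isWhite_step Φ x hi).2 hx)
    rw [step_step] at h1
    rw [← h1, step_step]

theorem IsChiral.not_isWhite_adj_self (hc : P.IsChiral) (Φ : P.Flag) (i : Fin n) :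
    ¬ IsWhite Φ (P.adj i Φ) := fun h => (hc.isWhite_adj Φ Φ i).1 h (isWhite_self Φ)

/-- A map commuting with the colours cannot exchange the two orbits of a finite chiral
premaniplex. -/
theorem IsChiral.map_base_ne (hc : P.IsChiral) (hP : P.IsPremaniplex) [Finite P.Flag]
    {f : P.Flag → P.Flag} (hf : ∀ i x, f (P.adj i x) = P.adj i (f x)) {Φ : P.Flag} {c : ℕ}
    (h : c < n) : f Φ ≠ P.step c Φ := by
  intro hΦ
  obtain ⟨σ, hσ, hfσ⟩ := hP.exists_aut hf
  exact hc.2 ⟨c, h⟩ Φ ⟨σ, hσ, by rw [hfσ, hΦ, step_of_lt h]⟩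

/-- Otherwise r_0 would commute with every colour, hence be an automorphism carrying Φ to an
adjacent flag. -/
theorem IsChiral.step_zero_one_ne (hc : P.IsChiral) (hP : P.IsPremaniplex) [Finite P.Flag]
    (hn : 1 < n) (Φ : P.Flag) : P.step 0 (P.step 1 Φ) ≠ P.step 1 (P.step 0 Φ) := by
  intro h
  have h01 := hc.step_comm_of_base Φ (by omega) h
  refine hc.map_base_ne hP (f := P.step 0) (Φ := Φ) (c := 0) ?_ (by omega) rfl
  intro i x
  rw [← step_val i, ← step_val i]
  rcases i with ⟨_ | _ | i, hi⟩
  · rfl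
  · exact h01 x
  · exact hP.step_comm (by simp) x

/-- The group generated by `r_0` and `r_1`. -/
def lowGroup (P : FlagGraph.{u} n) : Subgroup (Equiv.Perm P.Flag) :=
  Subgroup.closure {P.step 0, P.step 1}

/-- The group generated by the `r_j` with `j ≥ 2`. -/
def highGroup (P : FlagGraph.{u} n) : Subgroup (Equiv.Perm P.Flag) :=
  Subgroup.closure {σ | ∃ j, 2 ≤ j ∧ σ = P.step j}

theorem step_mul_step_self (c : ℕ) : P.step c * P.step c = 1 := Equiv.ext fun x => step_step c x

theorem step_inv (c : ℕ) : (P.step c)⁻¹ = P.step c := inv_eq_of_mul_eq_one_left (step_mul_step_self c)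

theorem joined_of_mem_closure {S : Set (Equiv.Perm P.Flag)} {T : Set (Fin n)}
    (hS : ∀ σ ∈ S, ∀ x, P.Joined T x (σ x)) {σ : Equiv.Perm P.Flag}
    (hσ : σ ∈ Subgroup.closure S) (x : P.Flag) : P.Joined T x (σ x) := by
  induction hσ using Subgroup.closure_induction generalizing x with
  | mem σ hσ => exact hS σ hσ x
  | one => exact Relation.ReflTransGen.refl
  | mul σ τ _ _ h₁ h₂ => exact (h₂ x).trans (h₁ (τ x))
  | inv σ _ h =>
    have := (h (σ⁻¹ x)).symm
    rwa [show σ (σ⁻¹ x) = x from σ.apply_symm_apply x] at this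

theorem joined_step {T : Set (Fin n)} {c : ℕ} (hT : ∀ h : c < n, (⟨c, h⟩ : Fin n) ∈ T)
    (x : P.Flag) : P.Joined T x (P.step c x) := by
  by_cases h : c < n
  · rw [step_of_lt h]
    exact joined_adj (hT h) x
  · rw [step, dif_neg h]
    exact Relation.ReflTransGen.refl

/-- An element of the dihedral group `⟨r_0, r_1⟩` either exchanges the orbits or is inverted by
`r_0`. -/
theorem lowGroup_cases (hc : P.IsChiral) (hn : 1 < n) (Φ : P.Flag) {a : Equiv.Perm P.Flag}
    (ha : a ∈ P.lowGroup) : (∀ x, IsWhite Φ (a x) ↔ ¬ IsWhite Φ x) ∨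
      P.step 0 * a * P.step 0 = a⁻¹ := by
  set u : Equiv.Perm P.Flag := P.step 1 * P.step 0 with hu
  have h00 := step_mul_step_self (P := P) 0
  have hconj : ∀ m : ℤ, P.step 0 * u ^ m * P.step 0 = u ^ (-m) := by
    intro m
    have h1 : P.step 0 * u * (P.step 0)⁻¹ = u⁻¹ := by
      rw [hu, mul_inv_rev, step_inv, step_inv, mul_assoc, mul_assoc, h00, mul_one]
    rw [zpow_neg, ← inv_zpow, ← h1, conj_zpow, step_inv]
  -- Dihedral normal form: rotations u^m preserve the orbits and are inverted by r_0, reflections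
  -- u^m r_0 exchange the orbits.
  have hform : ∃ m : ℤ, a = u ^ m ∨ a = u ^ m * P.step 0 := by
    have h0 : ∀ g : Equiv.Perm P.Flag, (∃ m : ℤ, g = u ^ m ∨ g = u ^ m * P.step 0) →
        ∃ m : ℤ, P.step 0 * g = u ^ m ∨ P.step 0 * g = u ^ m * P.step 0 := by
      rintro _ ⟨m, rfl | rfl⟩
      · refine ⟨-m, Or.inr ?_⟩
        rw [← hconj, mul_assoc, h00, mul_one]
      · refine ⟨-m, Or.inl ?_⟩
        rw [← hconj, mul_assoc]
    have h1 : ∀ g : Equiv.Perm P.Flag, (∃ m : ℤ, g = u ^ m ∨ g = u ^ m * P.step 0) →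
        ∃ m : ℤ, P.step 1 * g = u ^ m ∨ P.step 1 * g = u ^ m * P.step 0 := by
      intro g hg
      obtain ⟨m, h | h⟩ := h0 g hg
      · refine ⟨1 + m, Or.inl ?_⟩
        rw [zpow_one_add, ← h, hu, mul_assoc, ← mul_assoc (P.step 0), h00, one_mul]
      · refine ⟨1 + m, Or.inr ?_⟩
        rw [zpow_one_add, mul_assoc, ← h, hu, mul_assoc, ← mul_assoc (P.step 0), h00, one_mul]
    induction ha using Subgroup.closure_induction_left with
    | one => exact ⟨0, Or.inl rfl⟩
    | mul_left x hx y _ ih =>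
      rcases hx with rfl | rfl
      · exact h0 _ ih
      · exact h1 _ ih
    | inv_mul_cancel x hx y _ ih =>
      rcases hx with rfl | rfl <;> rw [step_inv]
      · exact h0 _ ih
      · exact h1 _ ih
  have hwhite : ∀ (m : ℤ) x, IsWhite Φ ((u ^ m) x) ↔ IsWhite Φ x := by
    let K : Subgroup (Equiv.Perm P.Flag) :=
      { carrier := {σ | ∀ x, IsWhite Φ (σ x) ↔ IsWhite Φ x}
        one_mem' := fun _ => Iff.rfl
        mul_mem' := fun {σ τ} h₁ h₂ x => (h₁ (τ x)).trans (h₂ x)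
        inv_mem' := fun {σ} h x => by
          rw [← h (σ⁻¹ x), show σ (σ⁻¹ x) = x from σ.apply_symm_apply x] }
    have hK : u ∈ K := fun x => by
      rw [hu, Equiv.Perm.mul_apply, hc.isWhite_step Φ _ hn, hc.isWhite_step Φ _ (by omega),
        not_not]
    exact fun m => K.zpow_mem hK m
  obtain ⟨m, rfl | rfl⟩ := hform
  · right
    rw [hconj, zpow_neg]
  · left
    intro x
    rw [Equiv.Perm.mul_apply, hwhite, hc.isWhite_step Φ _ (by omega)]

/-- A chiral polytope does not split as a join of a polygon with its co-faces. -/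
theorem IsChiral.step_one_two_ne (hc : P.IsChiral) (hP : P.IsPolytope) (hn : 2 < n) (Φ : P.Flag) :
    P.step 1 (P.step 2 Φ) ≠ P.step 2 (P.step 1 Φ) := by
  intro h
  have : Finite P.Flag := hP.finite
  have hpre := hP.toIsPremaniplex
  have h12 := hc.step_comm_of_base Φ (by omega) h
  have hjoin_low : ∀ a ∈ P.lowGroup, ∀ x, P.Joined {i | i ≤ ⟨1, by omega⟩} x (a x) := by
    intro a ha x
    refine joined_of_mem_closure ?_ ha x
    rintro _ (rfl | rfl) y <;> refine joined_step (fun hc => ?_) y <;> simp [Fin.le_def]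
  have hjoin_high : ∀ b ∈ P.highGroup, ∀ x, P.Joined {i | ⟨2, hn⟩ ≤ i} x (b x) := by
    intro b hb x
    refine joined_of_mem_closure ?_ hb x
    rintro _ ⟨j, hj, rfl⟩ y
    exact joined_step (fun hc => by simpa [Fin.le_def] using hj) y
  have hcomm : ∀ a ∈ P.lowGroup, ∀ b ∈ P.highGroup, ∀ x, a (b x) = b (a x) := by
    have hle : P.highGroup ≤ Subgroup.centralizer (P.lowGroup : Set (Equiv.Perm P.Flag)) := by
      rw [highGroup, lowGroup, Subgroup.centralizer_closure, Subgroup.closure_le]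
      rintro _ ⟨j, hj, rfl⟩
      rw [SetLike.mem_coe]
      rintro _ (rfl | rfl) <;> ext x
      · exact hpre.step_comm (by omega) x
      · rcases eq_or_lt_of_le hj with rfl | hj
        · exact h12 x
        · exact hpre.step_comm (by omega) x
    intro a ha b hb x
    exact Equiv.congr_fun (Subgroup.mem_centralizer_iff.1 (hle hb) a ha) x
  have h0mem : P.step 0 ∈ P.lowGroup := Subgroup.subset_closure (by simp)
  have h1mem : P.step 1 ∈ P.lowGroup := Subgroup.subset_closure (by simp)
  have hjmem : ∀ j, 2 ≤ j → P.step j ∈ P.highGroup := fun j hj =>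
    Subgroup.subset_closure ⟨j, hj, rfl⟩
  have hform : ∀ x, ∃ a ∈ P.lowGroup, ∃ b ∈ P.highGroup, x = a (b Φ) := by
    intro x
    refine (hpre.connected Φ x).induction
      (p := fun x => ∃ a ∈ P.lowGroup, ∃ b ∈ P.highGroup, x = a (b Φ))
      ⟨1, one_mem _, 1, one_mem _, rfl⟩ ?_
    rintro i _ _ ⟨a, ha, b, hb, rfl⟩
    rw [← step_val]
    rcases i with ⟨_ | _ | i, hi⟩
    · exact ⟨_, mul_mem h0mem ha, b, hb, rfl⟩
    · exact ⟨_, mul_mem h1mem ha, b, hb, rfl⟩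
    · exact ⟨a, ha, _, mul_mem (hjmem (i + 1 + 1) (by omega)) hb,
        (hcomm a ha _ (hjmem (i + 1 + 1) (by omega)) _).symm⟩
  -- If r_1 and r_2 commute, every flag is a b Φ with a in the low group and b in the high group,
  -- which commute. The map a b Φ ↦ a r_0 b Φ will be an automorphism moving Φ to an adjacent flag;
  -- this is its well-definedness.
  have huniq : ∀ a ∈ P.lowGroup, ∀ b ∈ P.highGroup, ∀ a' ∈ P.lowGroup, ∀ b' ∈ P.highGroup,
      a (b Φ) = a' (b' Φ) → a (P.step 0 (b Φ)) = a' (P.step 0 (b' Φ)) := by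
    intro a ha b hb a' ha' b' hb' hab
    obtain ⟨c, hc', rfl⟩ : ∃ c ∈ P.lowGroup, a = a' * c :=
      ⟨a'⁻¹ * a, mul_mem (inv_mem ha') ha, by group⟩
    simp only [Equiv.Perm.mul_apply, EmbeddingLike.apply_eq_iff_eq] at hab ⊢
    have hbb : b' Φ = b Φ := by
      refine (hP.path_intersection ⟨2, hn⟩ ⟨1, by omega⟩ (b Φ) (b' Φ) ?_ ?_).eq_of_isEmpty ?_
      · rw [← hab]
        exact hjoin_low c hc' _
      · exact (hjoin_high b hb Φ).symm.trans (hjoin_high b' hb' Φ)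
      · intro i hi
        simp only [Set.mem_ofPred_eq, Fin.le_def] at hi
        omega
    rw [hbb] at hab ⊢
    -- As c fixes b Φ, it cannot exchange the orbits. So r_0 inverts c, and c fixes r_0 b Φ as well.
    rcases lowGroup_cases hc (by omega) Φ hc' with hflip | hinv
    · have := hflip (b Φ)
      rw [hab] at this
      tauto
    · have h1 := Equiv.congr_fun hinv (b Φ)
      rw [show c⁻¹ (b Φ) = b Φ from (Equiv.symm_apply_eq c).2 hab.symm] at h1
      have h2 := congrArg (P.step 0) h1
      simpa using h2
  choose a ha b hb hab using hform
  have hf : ∀ a' ∈ P.lowGroup, ∀ b' ∈ P.highGroup,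
      a (a' (b' Φ)) (P.step 0 (b (a' (b' Φ)) Φ)) = a' (P.step 0 (b' Φ)) :=
    fun a' ha' b' hb' => huniq _ (ha _) _ (hb _) _ ha' _ hb' (hab _).symm
  refine hc.map_base_ne hpre (f := fun x => a x (P.step 0 (b x Φ))) (Φ := Φ) (c := 0) ?_
    (by omega) (hf 1 (one_mem _) 1 (one_mem _))
  intro i x
  have hx : P.adj i x = P.step i (a x (b x Φ)) := by rw [← hab, step_val]
  rw [hx, ← step_val i]
  rcases i with ⟨_ | _ | i, hi⟩
  · exact hf _ (mul_mem h0mem (ha x)) _ (hb x)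
  · exact hf _ (mul_mem h1mem (ha x)) _ (hb x)
  · have hj := hjmem (i + 1 + 1) (by omega)
    show a (P.step (i + 1 + 1) _) (P.step 0 (b (P.step (i + 1 + 1) _) Φ)) = _
    rw [← hcomm _ (ha x) _ hj, ← hcomm _ (ha x) _ hj, ← hcomm _ h0mem _ hj]
    exact hf _ (ha x) _ (mul_mem hj (hb x))

end Chiral

/-! ### Products of voltages around a vertex -/

section Turn

variable {Γ : Type v} [Group Γ]

theorem edgeVoltage_natCast {k : ℕ} (hk : 0 < k) (τ : Fin (2 * k) → Γ) {c : ℕ} (hc : c < 2 * k) :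
    edgeVoltage k hk τ (c : ZMod (4 * k)) = τ ⟨c, hc⟩ := by
  have hv : (c : ZMod (4 * k)).val = c := ZMod.val_natCast_of_lt (by omega)
  rw [edgeVoltage, dif_pos (by omega)]
  simp only [hv]

/-- The voltage of the walk around a vertex of the derived graph that crosses `t` edges, the
first of them being `e_0`. -/
def turn (k : ℕ) (hk : 0 < k) (τ : Fin (2 * k) → Γ) : ℕ → Γ
  | 0 => 1
  | t + 1 => edgeVoltage k hk τ ((t * (2 * k + 1) : ℕ) : ZMod (4 * k)) * turn k hk τ t

/-- Modulo 4k, (2kq + c)(2k + 1) equals c + 2k(q + c): the edge e_c or its opposite, by the parity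
of q + c. -/
theorem edgeVoltage_turn {k : ℕ} (hk : 0 < k) (τ : Fin (2 * k) → Γ) (q : ℕ) {c : ℕ}
    (hc : c < 2 * k) :
    edgeVoltage k hk τ (((2 * k * q + c) * (2 * k + 1) : ℕ) : ZMod (4 * k)) =
      if Even (q + c) then τ ⟨c, hc⟩ else (τ ⟨c, hc⟩)⁻¹ := by
  have h0 : ((4 * k : ℕ) : ZMod (4 * k)) = 0 := ZMod.natCast_self _
  have h : ∀ d, q + c = 2 * d ∨ q + c = 2 * d + 1 →
      (2 * k * q + c) * (2 * k + 1) = (4 * k) * (k * q + d) + (c + (q + c - 2 * d) * (2 * k)) := by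
    intro d hd
    obtain ⟨e, he⟩ : ∃ e, q + c = 2 * d + e := ⟨q + c - 2 * d, by omega⟩
    have h2 : (2 * k * q + c) * (2 * k + 1) = 4 * k * (k * q) + (2 * k) * (q + c) + c := by ring
    rw [h2, he, Nat.add_sub_cancel_left]
    ring
  split_ifs with he
  · obtain ⟨d, hd⟩ := he
    rw [h d (Or.inl (by omega)), Nat.cast_add, Nat.cast_mul, h0, zero_mul, zero_add,
      show c + (q + c - 2 * d) * (2 * k) = c by rw [show q + c - 2 * d = 0 by omega]; omega,
      edgeVoltage_natCast hk τ hc]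
  · obtain ⟨d, hd⟩ := Nat.not_even_iff_odd.1 he
    rw [h d (Or.inr hd), Nat.cast_add, Nat.cast_mul, h0, zero_mul, zero_add,
      show c + (q + c - 2 * d) * (2 * k) = c + 2 * k by
        rw [show q + c - 2 * d = 1 by omega]; omega,
      Nat.cast_add, edgeVoltage_opposite, edgeVoltage_natCast hk τ hc]

theorem turn_add_period {k : ℕ} (hk : 0 < k) (τ : Fin (2 * k) → Γ) (t : ℕ) :
    turn k hk τ (t + 4 * k) = turn k hk τ t * turn k hk τ (4 * k) := by
  induction t with
  | zero => simp [turn]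
  | succ t ih =>
    rw [show t + 1 + 4 * k = (t + 4 * k) + 1 by ring, turn, ih, turn, mul_assoc]
    congr 2
    have h0 : ((4 * k : ℕ) : ZMod (4 * k)) = 0 := ZMod.natCast_self _
    rw [add_mul, Nat.cast_add, Nat.cast_mul (4 * k), h0, zero_mul, add_zero]

/-- The properties of the group of a chiral polytope, with its distinguished generators, that
determine the derived graph. -/
structure IsPetrieSimpleChiral (k : ℕ) (hk : 0 < k) (τ : Fin (2 * k) → Γ) : Prop where
  closure : Subgroup.closure (Set.range τ) = ⊤
  ne_one : ∀ a, τ a ≠ 1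
  sq_eq_one : ∀ a : Fin (2 * k), 0 < (a : ℕ) → τ a * τ a = 1
  sq_ne_one : ∀ h : 0 < 2 * k, τ ⟨0, h⟩ * τ ⟨0, h⟩ ≠ 1
  first_last : ∀ h : 0 < 2 * k, (τ ⟨0, h⟩ * τ ⟨2 * k - 1, Nat.sub_one_lt_of_lt h⟩) *
    (τ ⟨0, h⟩ * τ ⟨2 * k - 1, Nat.sub_one_lt_of_lt h⟩) = 1
  first_second : ∀ h : 1 < 2 * k, (τ ⟨0, Nat.zero_lt_of_lt h⟩ * τ ⟨1, h⟩) *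
    (τ ⟨0, Nat.zero_lt_of_lt h⟩ * τ ⟨1, h⟩) ≠ 1
  not_reflexible : ¬ ∃ ψ : Γ →* Γ, ∀ a, ψ (τ a) = (τ a)⁻¹
  turn_injective : ∀ s t, turn k hk τ s = turn k hk τ t →
    (s : ZMod (4 * k)) = (t : ZMod (4 * k))

end Turn

/-! ### The distinguished generators of the automorphism group -/

section Distinguished

variable {m : ℕ} {P : FlagGraph.{u} (m + 1)} {Φ : P.Flag} {τ : Fin m → P.RightAut}

theorem IsChiral.existsUnique_isDistinguishedFamily (hc : P.IsChiral) (hP : P.IsPremaniplex)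
    (Φ : P.Flag) : ∃! τ : Fin m → P.RightAut, P.IsDistinguishedFamily Φ τ := by
  have h : ∀ j : Fin m, ∃ γ : P.RightAut, act Φ γ = P.r j.succ (P.r 0 Φ) := fun j =>
    (hc.isWhite_adj Φ _ _).2 (hc.not_isWhite_adj_self Φ 0)
  choose τ hτ using h
  exact ⟨τ, hτ, fun τ' hτ' => funext fun j => hP.act_injective Φ ((hτ' j).trans (hτ j).symm)⟩

/-- Automorphisms commute with the r_i, so left multiplication by a generator becomes a monodromy of
the flag Φγ. This turns voltage products into walks on flags. -/
theorem IsDistinguishedFamily.act_mul (hτ : P.IsDistinguishedFamily Φ τ) {j : ℕ} (hj : j < m)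
    (γ : P.RightAut) :
    act Φ (τ ⟨j, hj⟩ * γ) = P.step (j + 1) (P.step 0 (act Φ γ)) := by
  have h : act Φ (τ ⟨j, hj⟩) = P.step (j + 1) (P.step 0 Φ) := by
    rw [hτ, step_of_lt (c := j + 1) (by omega), step_of_lt (c := 0) (by omega)]
    rfl
  rw [FlagGraph.act_mul, h, act_step, act_step]

theorem IsDistinguishedFamily.act_inv_mul (hτ : P.IsDistinguishedFamily Φ τ) {j : ℕ} (hj : j < m)
    (γ : P.RightAut) :
    act Φ ((τ ⟨j, hj⟩)⁻¹ * γ) = P.step 0 (P.step (j + 1) (act Φ γ)) := by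
  have h := hτ.act_mul hj ((τ ⟨j, hj⟩)⁻¹ * γ)
  rw [mul_inv_cancel_left] at h
  rw [h, step_step, step_step]

/-- The flags Φγ and r_0Φγ, with γ in the generated subgroup, are closed under all colours, hence
exhaust the flags. The orbit of Φ contains none of the second kind. -/
theorem IsDistinguishedFamily.closure_eq_top (hτ : P.IsDistinguishedFamily Φ τ)
    (hP : P.IsPremaniplex) (hc : P.IsChiral) : Subgroup.closure (Set.range τ) = ⊤ := by
  have key : ∀ x, ∃ γ ∈ Subgroup.closure (Set.range τ), x = act Φ γ ∨ x = P.step 0 (act Φ γ) := by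
    intro x
    refine (hP.connected Φ x).induction (p := fun x => ∃ γ ∈ Subgroup.closure (Set.range τ),
      x = act Φ γ ∨ x = P.step 0 (act Φ γ)) ⟨1, one_mem _, Or.inl rfl⟩ ?_
    rintro ⟨_ | i, hi⟩ _ x ⟨γ, hγ, rfl | rfl⟩ <;> rw [← step_of_lt hi]
    · exact ⟨γ, hγ, Or.inr rfl⟩
    · exact ⟨γ, hγ, Or.inl (step_step _ _)⟩
    · refine ⟨(τ ⟨i, by omega⟩)⁻¹ * γ,
        mul_mem (inv_mem (Subgroup.subset_closure ⟨_, rfl⟩)) hγ, Or.inr ?_⟩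
      rw [hτ.act_inv_mul, step_step]
    · refine ⟨τ ⟨i, by omega⟩ * γ, mul_mem (Subgroup.subset_closure ⟨_, rfl⟩) hγ, Or.inl ?_⟩
      rw [hτ.act_mul]
  rw [eq_top_iff]
  intro δ _
  obtain ⟨γ, hγ, h | h⟩ := key (act Φ δ)
  · rwa [hP.act_injective Φ h]
  · have := (hc.isWhite_step Φ (act Φ γ) (c := 0) (by omega)).1 (h ▸ ⟨δ, rfl⟩)
    exact absurd ⟨γ, rfl⟩ this

theorem IsDistinguishedFamily.not_reflexible (hτ : P.IsDistinguishedFamily Φ τ)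
    (hP : P.IsPremaniplex) [Finite P.Flag] (hc : P.IsChiral) :
    ¬ ∃ ψ : P.RightAut →* P.RightAut, ∀ a, ψ (τ a) = (τ a)⁻¹ := by
  rintro ⟨ψ, hψ⟩
  have key : ∀ x, ∃ γ : P.RightAut, (x = act Φ γ ∧ IsWhite Φ x) ∨
      (x = P.step 0 (act Φ γ) ∧ ¬ IsWhite Φ x) := by
    intro x
    by_cases hx : IsWhite Φ x
    · obtain ⟨γ, hγ⟩ := id hx
      exact ⟨γ, Or.inl ⟨hγ.symm, hx⟩⟩
    · obtain ⟨γ, hγ⟩ := (hc.isWhite_step Φ x (c := 0) (by omega)).2 hx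
      exact ⟨γ, Or.inr ⟨by rw [hγ, step_step], hx⟩⟩
  choose g hg using key
  classical
  -- The reflection induced by ψ: Φγ ↦ r_0 Φψ(γ) and r_0Φγ ↦ Φψ(γ). Inverting the generators
  -- exchanges r_j r_0 with r_0 r_j, so this map respects the colours, yet it sends Φ to r_0Φ.
  let f : P.Flag → P.Flag := fun x =>
    if IsWhite Φ x then P.step 0 (act Φ (ψ (g x))) else act Φ (ψ (g x))
  have hf1 : ∀ γ, f (act Φ γ) = P.step 0 (act Φ (ψ γ)) := by
    intro γ
    have hw : IsWhite Φ (act Φ γ) := ⟨γ, rfl⟩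
    rcases hg (act Φ γ) with ⟨h, _⟩ | ⟨_, h⟩
    · simp only [f, if_pos hw]
      rw [← hP.act_injective Φ h]
    · exact absurd hw h
  have hf2 : ∀ γ, f (P.step 0 (act Φ γ)) = act Φ (ψ γ) := by
    intro γ
    have hw : ¬ IsWhite Φ (P.step 0 (act Φ γ)) := by
      rw [hc.isWhite_step Φ _ (by omega), not_not]
      exact ⟨γ, rfl⟩
    rcases hg (P.step 0 (act Φ γ)) with ⟨_, h⟩ | ⟨h, _⟩
    · exact absurd h hw
    · simp only [f, if_neg hw]
      rw [← hP.act_injective Φ ((P.step 0).injective h)]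
  refine hc.map_base_ne hP (f := f) (Φ := Φ) (c := 0) ?_ (by omega)
    ((hf1 1).trans (by rw [map_one, act_one]))
  intro i x
  rw [← step_val, ← step_val]
  have hx : ∃ γ, x = act Φ γ ∨ x = P.step 0 (act Φ γ) :=
    ⟨g x, (hg x).imp And.left And.left⟩
  rcases i with ⟨_ | i, hi⟩
  · obtain ⟨γ, rfl | rfl⟩ := hx
    · exact (hf2 γ).trans (by rw [hf1, step_step])
    · simp only [step_step, hf1, hf2]
  · have him : i < m := by omega
    obtain ⟨γ, rfl | rfl⟩ := hx
    · have h := hτ.act_inv_mul him γ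
      show f (P.step (i + 1) _) = P.step (i + 1) _
      rw [← step_step 0 (P.step (i + 1) _), ← h, hf2, map_mul, map_inv, hψ, inv_inv, hτ.act_mul,
        hf1]
    · show f (P.step (i + 1) _) = P.step (i + 1) _
      rw [← hτ.act_mul him, hf1, hf2, map_mul, hψ, hτ.act_inv_mul, step_step]

end Distinguished

/-! ### The walk around a vertex follows a Petrie polygon -/

section Odd

variable {k : ℕ} {P : FlagGraph.{u} (2 * k + 1)} {Φ : P.Flag} {τ : Fin (2 * k) → P.RightAut}

/-- A Petrie step crosses 2k + 1 edges, an odd number, so it exchanges the two orbits. -/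
theorem isWhite_petrie_pow (hc : P.IsChiral) (Φ : P.Flag) (q : ℕ) :
    IsWhite Φ ((P.walk (2 * k + 1) ^ q) Φ) ↔ Even q := by
  induction q with
  | zero => simpa using isWhite_self Φ
  | succ q ih =>
    rw [pow_succ', Equiv.Perm.mul_apply, hc.isWhite_walk Φ _ le_rfl, ih, Nat.even_add_one,
      Nat.even_add_one]
    have := even_two_mul k
    tauto

/-- The walk around a vertex of the derived graph follows a Petrie polygon, up to `r_0`. -/
theorem IsDistinguishedFamily.act_turn (hτ : P.IsDistinguishedFamily Φ τ) (hk : 0 < k)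
    (hP : P.IsPremaniplex) (hc : P.IsChiral) (q c : ℕ) (hcq : c ≤ 2 * k) :
    act Φ (turn k hk τ (2 * k * q + c)) = P.walk (c + 1) ((P.walk (2 * k + 1) ^ q) Φ) ∨
      act Φ (turn k hk τ (2 * k * q + c)) =
        P.step 0 (P.walk (c + 1) ((P.walk (2 * k + 1) ^ q) Φ)) := by
  have hw1 : ∀ x : P.Flag, P.walk 1 x = P.step 0 x := fun _ => rfl
  have hstep : ∀ q c, c < 2 * k →
      (act Φ (turn k hk τ (2 * k * q + c)) = P.walk (c + 1) ((P.walk (2 * k + 1) ^ q) Φ) ∨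
      act Φ (turn k hk τ (2 * k * q + c)) =
        P.step 0 (P.walk (c + 1) ((P.walk (2 * k + 1) ^ q) Φ))) →
      (act Φ (turn k hk τ (2 * k * q + (c + 1))) =
        P.walk (c + 1 + 1) ((P.walk (2 * k + 1) ^ q) Φ) ∨
      act Φ (turn k hk τ (2 * k * q + (c + 1))) =
        P.step 0 (P.walk (c + 1 + 1) ((P.walk (2 * k + 1) ^ q) Φ))) := by
    intro q c hcq h
    rw [← add_assoc, turn, edgeVoltage_turn hk τ q hcq, walk_succ (c + 1)]
    rcases Nat.eq_zero_or_pos c with rfl | hc0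
    -- Here r_0 and r_1 need not commute. Instead, the orbit of the q-th Petrie flag decides which
    -- of the two alternatives holds, in agreement with the exponent of τ_1.
    · simp only [zero_add, add_zero, hw1, step_step] at h ⊢
      have hwh := isWhite_petrie_pow hc Φ q
      have hwa : IsWhite Φ (act Φ (turn k hk τ (2 * k * q))) := ⟨_, rfl⟩
      split_ifs with he
      · rcases h with h | h
        · rw [h, hc.isWhite_step Φ _ (by omega)] at hwa
          exact absurd (hwh.2 he) hwa
        · left
          rw [hτ.act_mul, h]
      · rcases h with h | h
        · right
          rw [hτ.act_inv_mul, h]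
        · rw [h] at hwa
          exact absurd (hwh.1 hwa) he
    · have hcomm := fun x => hP.step_comm (i := 0) (j := c + 1) (by omega) x
      split_ifs with he
      · rcases h with h | h
        · right
          rw [hτ.act_mul, h, hcomm]
        · left
          rw [hτ.act_mul, h, step_step]
      · rcases h with h | h
        · right
          rw [hτ.act_inv_mul, h]
        · left
          rw [hτ.act_inv_mul, h, ← hcomm, step_step]
  have hcol : ∀ q, (act Φ (turn k hk τ (2 * k * q)) = P.walk 1 ((P.walk (2 * k + 1) ^ q) Φ) ∨
      act Φ (turn k hk τ (2 * k * q)) = P.step 0 (P.walk 1 ((P.walk (2 * k + 1) ^ q) Φ))) →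
      ∀ c ≤ 2 * k,
      (act Φ (turn k hk τ (2 * k * q + c)) = P.walk (c + 1) ((P.walk (2 * k + 1) ^ q) Φ) ∨
      act Φ (turn k hk τ (2 * k * q + c)) =
        P.step 0 (P.walk (c + 1) ((P.walk (2 * k + 1) ^ q) Φ))) := by
    intro q hq c
    induction c with
    | zero => intro _; exact hq
    | succ c ih => exact fun h => hstep q c (by omega) (ih (by omega))
  refine hcol q ?_ c hcq
  clear hcq c
  induction q with
  | zero =>
    right
    simp only [hw1, step_step, mul_zero, pow_zero]
    rfl
  | succ q ih =>
    have := hcol q ih (2 * k) le_rfl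
    rw [hw1, step_step, pow_succ', Equiv.Perm.mul_apply, mul_add, mul_one]
    exact this.symm

end Odd

/-! ### Vertices along a Petrie polygon -/

section Petrie

variable {n : ℕ} {P : FlagGraph.{u} (n + 1)}

theorem HasSimplePetriePolygons.eq_of_joined (h : P.HasSimplePetriePolygons) {Φ : P.Flag} {a b : ℕ}
    (hab : P.Joined {j | j ≠ 0} ((P.walk (n + 1) ^ a) Φ) ((P.walk (n + 1) ^ b) Φ)) :
    (P.walk (n + 1) ^ a) Φ = (P.walk (n + 1) ^ b) Φ := by
  by_contra hne
  refine h Φ _ ⟨a, ?_⟩ _ ⟨b, ?_⟩ hne (face_eq_face_iff.2 hab) <;>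
    rw [petrieMonodromy_eq_walk, zpow_natCast]

theorem joined_walk_end {c : ℕ} (hc : c ≤ n) (x : P.Flag) :
    P.Joined {j | j ≠ 0} (P.walk (c + 1) x) (P.walk (n + 1) x) := by
  refine (joined_walk (by omega) le_rfl x).mono fun i hi => ?_
  have := hi.1
  rintro rfl
  simp at this

/-- Completing the walk on the far side of the 0-edge reaches r_0 M x, with M the Petrie monodromy;
this is the first stage of the next Petrie step, so it has the vertex of M² x. -/
theorem IsPremaniplex.joined_step_zero_walk_end (hP : P.IsPremaniplex) {c : ℕ} (hc : c + 1 ≤ n)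
    (x : P.Flag) : P.Joined {j | j ≠ 0} (P.step 0 (P.walk (c + 2) x))
      (P.walk (n + 1) (P.walk (n + 1) x)) := by
  have h1 := hP.joined_step_zero_walk (a := c + 2) (b := n + 1) (by omega) (by omega) le_rfl x
  refine (h1.mono fun i hi => ?_).trans (joined_walk_end (c := 0) (by omega) _)
  rintro rfl
  simp at hi

/-- Otherwise r_0 r_1 r_0 Φ has the vertex of Φ, and path intersection makes it Φ or r_1Φ. The first
contradicts the parity of orbits, the second that r_0 and r_1 do not commute. -/
theorem IsChiral.petrie_sq_ne (hc : P.IsChiral) (hP : P.IsPolytope) (hn : 2 ≤ n) (Φ : P.Flag) :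
    P.walk (n + 1) (P.walk (n + 1) Φ) ≠ Φ := by
  intro h
  have : Finite P.Flag := hP.finite
  have h1 := hP.joined_step_zero_walk_end (c := 0) (by omega) Φ
  rw [h] at h1
  have hw : P.walk (0 + 2) Φ = P.step 1 (P.step 0 Φ) := rfl
  rw [hw] at h1
  have hlow : P.Joined {i | i ≤ ⟨1, by omega⟩} Φ (P.step 0 (P.step 1 (P.step 0 Φ))) := by
    have h0 : ∀ x, P.Joined {i | i ≤ ⟨1, by omega⟩} x (P.step 0 x) :=
      joined_step fun h => by simp [Fin.le_def]
    have h1 : ∀ x, P.Joined {i | i ≤ ⟨1, by omega⟩} x (P.step 1 x) :=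
      joined_step fun h => by simp
    exact ((h0 _).trans (h1 _)).trans (h0 _)
  have hhigh : P.Joined {i | ⟨1, by omega⟩ ≤ i} Φ (P.step 0 (P.step 1 (P.step 0 Φ))) := by
    refine h1.symm.mono fun i hi => ?_
    have hi' : (i : ℕ) ≠ 0 := fun h0 => hi (Fin.ext h0)
    simp only [Set.mem_ofPred_eq, Fin.le_def]
    omega
  rcases (hP.path_intersection _ _ _ _ hlow hhigh).eq_or_eq_adj (i := ⟨1, by omega⟩)
    (fun j hj => le_antisymm hj.2 hj.1) with h2 | h2
  · have hw := isWhite_self Φ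
    rw [← h2, hc.isWhite_step _ _ (by omega), h2, hc.isWhite_step _ _ (by omega),
      hc.isWhite_step _ _ (by omega)] at hw
    exact hw (by simpa using isWhite_self Φ)
  · rw [← step_of_lt (c := 1) (by omega)] at h2
    refine hc.step_zero_one_ne hP.toIsPremaniplex (by omega) Φ ?_
    rw [← h2, step_step]

end Petrie

/-! ### Injectivity of the turns modulo 4k -/

section Odd

variable {k : ℕ} {P : FlagGraph.{u} (2 * k + 1)} {Φ : P.Flag} {τ : Fin (2 * k) → P.RightAut}

/-- Equal turns give partial Petrie walks that agree up to r_0. Vertices then identify Petrie flags: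
agreement on the nose gives equal Petrie flags, and `walk_ne` compares the partial walks; agreement
through r_0 would make the square of the Petrie monodromy fix a flag. -/
theorem IsDistinguishedFamily.turn_eq (hτ : P.IsDistinguishedFamily Φ τ) (hk : 0 < k)
    (hP : P.IsPolytope) (hc : P.IsChiral) (hpetrie : P.HasSimplePetriePolygons)
    {q c q' c' : ℕ} (hcq : c < 2 * k) (hcq' : c' < 2 * k)
    (h : turn k hk τ (2 * k * q + (c + 1)) = turn k hk τ (2 * k * q' + (c' + 1))) :
    c = c' ∧ (Even q ↔ Even q') := by
  have hpre := hP.toIsPremaniplex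
  have hpow : ∀ q, P.walk (2 * k + 1) ((P.walk (2 * k + 1) ^ q) Φ) =
      (P.walk (2 * k + 1) ^ (q + 1)) Φ := fun q => by rw [pow_succ', Equiv.Perm.mul_apply]
  have hv : ∀ q c, c < 2 * k → P.Joined {j | j ≠ 0}
      (P.walk (c + 1 + 1) ((P.walk (2 * k + 1) ^ q) Φ)) ((P.walk (2 * k + 1) ^ (q + 1)) Φ) := by
    intro q c hc
    rw [← hpow]
    exact joined_walk_end (by omega) _
  have hv' : ∀ q c, c < 2 * k → P.Joined {j | j ≠ 0}
      (P.step 0 (P.walk (c + 1 + 1) ((P.walk (2 * k + 1) ^ q) Φ)))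
      ((P.walk (2 * k + 1) ^ (q + 1 + 1)) Φ) := by
    intro q c hc
    rw [← hpow, ← hpow]
    exact hpre.joined_step_zero_walk_end (by omega) _
  have hcase : P.walk (c + 1 + 1) ((P.walk (2 * k + 1) ^ q) Φ) =
        P.walk (c' + 1 + 1) ((P.walk (2 * k + 1) ^ q') Φ) ∨
      P.walk (c + 1 + 1) ((P.walk (2 * k + 1) ^ q) Φ) =
        P.step 0 (P.walk (c' + 1 + 1) ((P.walk (2 * k + 1) ^ q') Φ)) := by
    have h1 := hτ.act_turn hk hpre hc q (c + 1) (by omega)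
    have h2 := hτ.act_turn hk hpre hc q' (c' + 1) (by omega)
    rw [← h] at h2
    rcases h1 with h1 | h1 <;> rcases h2 with h2 | h2 <;> rw [h1] at h2
    · exact Or.inl h2
    · exact Or.inr h2
    · exact Or.inr (by rw [← h2, step_step])
    · exact Or.inl ((P.step 0).injective h2)
  rcases hcase with he | he
  · have h1 : (P.walk (2 * k + 1) ^ q) Φ = (P.walk (2 * k + 1) ^ q') Φ := by
      apply (P.walk (2 * k + 1)).injective
      rw [hpow, hpow]
      refine hpetrie.eq_of_joined ((hv q c hcq).symm.trans ?_)
      rw [he]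
      exact hv q' c' hcq'
    refine ⟨?_, ?_⟩
    · rw [h1] at he
      rcases lt_trichotomy c c' with hlt | heq | hlt
      · exact absurd he (hP.walk_ne (by omega) (by omega) _)
      · exact heq
      · exact absurd he.symm (hP.walk_ne (by omega) (by omega) _)
    · rw [← isWhite_petrie_pow hc Φ, h1, isWhite_petrie_pow hc Φ]
  · exfalso
    have h1 : (P.walk (2 * k + 1) ^ (q + 1)) Φ = (P.walk (2 * k + 1) ^ (q' + 1 + 1)) Φ := by
      refine hpetrie.eq_of_joined ((hv q c hcq).symm.trans ?_)
      rw [he]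
      exact hv' q' c' hcq'
    have h2 : (P.walk (2 * k + 1) ^ (q + 1 + 1)) Φ = (P.walk (2 * k + 1) ^ (q' + 1)) Φ := by
      refine hpetrie.eq_of_joined ((hv' q c hcq).symm.trans ?_)
      rw [he, step_step]
      exact hv q' c' hcq'
    refine hc.petrie_sq_ne hP (by omega) ((P.walk (2 * k + 1) ^ (q' + 1)) Φ) ?_
    rw [hpow, ← h1, hpow, h2]

theorem IsDistinguishedFamily.turn_injective (hτ : P.IsDistinguishedFamily Φ τ) (hk : 0 < k)
    (hP : P.IsPolytope) (hc : P.IsChiral) (hpetrie : P.HasSimplePetriePolygons) {s t : ℕ}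
    (h : turn k hk τ s = turn k hk τ t) : (s : ZMod (4 * k)) = (t : ZMod (4 * k)) := by
  -- Adding the full period 4k makes the number positive, so that it has the form 2kq + (c + 1) even
  -- for s = 0.
  have hform : ∀ s : ℕ, ∃ q c, c < 2 * k ∧ s + 4 * k = 2 * k * q + (c + 1) := by
    intro s
    refine ⟨(s + 4 * k - 1) / (2 * k), (s + 4 * k - 1) % (2 * k), Nat.mod_lt _ (by omega), ?_⟩
    have := Nat.div_add_mod (s + 4 * k - 1) (2 * k)
    omega
  obtain ⟨q, c, hcq, hs⟩ := hform s
  obtain ⟨q', c', hcq', ht⟩ := hform t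
  have hst : turn k hk τ (s + 4 * k) = turn k hk τ (t + 4 * k) := by
    rw [turn_add_period, turn_add_period, h]
  rw [hs, ht] at hst
  obtain ⟨rfl, heven⟩ := hτ.turn_eq hk hP hc hpetrie hcq hcq' hst
  rw [ZMod.natCast_eq_natCast_iff]
  apply Nat.ModEq.add_right_cancel' (4 * k)
  rw [hs, ht]
  apply Nat.ModEq.add_right
  rw [show 4 * k = 2 * k * 2 by ring]
  apply Nat.ModEq.mul_left'
  rw [Nat.even_iff, Nat.even_iff] at heven
  unfold Nat.ModEq
  omega

/-- An automorphism is determined by the image of Φ, so each relation is tested at Φ, where it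
becomes a word in the r_i. -/
theorem IsDistinguishedFamily.isPetrieSimpleChiral (hτ : P.IsDistinguishedFamily Φ τ) (hk : 2 ≤ k)
    (hP : P.IsPolytope) (hc : P.IsChiral) (hpetrie : P.HasSimplePetriePolygons) :
    IsPetrieSimpleChiral k (Nat.zero_lt_of_lt hk) τ := by
  have : Finite P.Flag := hP.finite
  have hpre := hP.toIsPremaniplex
  have hone : ∀ γ : P.RightAut, act Φ γ = Φ ↔ γ = 1 := fun γ =>
    ⟨fun h => hpre.act_injective Φ h, fun h => by rw [h, act_one]⟩
  have hbase : ∀ j (hj : j < 2 * k), act Φ (τ ⟨j, hj⟩) = P.step (j + 1) (P.step 0 Φ) := by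
    intro j hj
    have := hτ.act_mul hj 1
    rwa [mul_one, act_one] at this
  have hsq : ∀ h : 0 < 2 * k, ∀ j (hj : j < 2 * k), act Φ ((τ ⟨0, h⟩ * τ ⟨j, hj⟩) *
      (τ ⟨0, h⟩ * τ ⟨j, hj⟩)) = P.step 1 (P.step 0 (P.step (j + 1) (P.step 0
        (P.step 1 (P.step 0 (P.step (j + 1) (P.step 0 Φ))))))) := by
    intro h j hj
    rw [mul_assoc, hτ.act_mul, hτ.act_mul, hτ.act_mul, hbase]
  have hcomm0 : ∀ {j}, 0 < j → ∀ x, P.step 0 (P.step (j + 1) x) = P.step (j + 1) (P.step 0 x) :=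
    fun hj x => hpre.step_comm (by omega) x
  refine ⟨hτ.closure_eq_top hpre hc, ?_, ?_, ?_, ?_, ?_, hτ.not_reflexible hpre hc,
    fun s t h => hτ.turn_injective _ hP hc hpetrie h⟩
  · rintro ⟨j, hj⟩
    rw [Ne, ← hone, hbase, step_of_lt (c := j + 1) (by omega), step_of_lt (c := 0) (by omega)]
    intro h
    have h2 := congrArg (P.adj ⟨j + 1, by omega⟩) h
    rw [P.adj_adj] at h2
    exact hP.no_parallel _ _ Φ (by simp [Fin.ext_iff]) h2
  · rintro ⟨j, hj⟩ hj0
    rw [← hone, hτ.act_mul, hbase, hcomm0 hj0, step_step, step_step]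
  · intro h
    rw [Ne, ← hone, hτ.act_mul, hbase]
    intro h2
    refine hc.step_zero_one_ne hpre (by omega) Φ ?_
    have h3 := congrArg (fun x => P.step 0 (P.step 1 x)) h2
    simpa using h3.symm
  · intro h
    have h1 : 0 < 2 * k - 1 := by omega
    -- The colours 1 and 2k are not consecutive because k ≥ 2.
    have hcomm1 : ∀ x, P.step 1 (P.step (2 * k - 1 + 1) x) = P.step (2 * k - 1 + 1) (P.step 1 x) :=
      fun x => hpre.step_comm (by omega) x
    rw [← hone, hsq]
    simp only [hcomm0 h1, step_step, hcomm1]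
  · intro h
    rw [Ne, ← hone, hsq]
    simp only [hcomm0 one_pos, step_step]
    intro h2
    refine hc.step_one_two_ne hP (by omega) Φ ?_
    have h3 := congrArg (fun x => P.step 2 (P.step 1 x)) h2
    simpa using h3

end Odd

/-! ### Symmetries of the base premaniplex compatible with the voltages -/

section Family2

variable {k : ℕ}

theorem joined_family2 (hk : 0 < k) (x y : (family2 k).Flag) :
    (family2 k).Joined {j | j ≠ 2} x y := by
  have : NeZero (4 * k) := ⟨by omega⟩
  have h0 : (0 : Fin 3) ∈ {j : Fin 3 | j ≠ 2} := by simp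
  have h1 : (1 : Fin 3) ∈ {j : Fin 3 | j ≠ 2} := by simp
  have key : ∀ t : ℕ, (family2 k).Joined {j | j ≠ 2} (0, false) ((t : ZMod (4 * k)), false) := by
    intro t
    induction t with
    | zero => rw [Nat.cast_zero]; exact Relation.ReflTransGen.refl
    | succ t ih =>
      rw [Nat.cast_succ]
      exact (ih.trans (joined_adj h0 _)).trans (joined_adj (G := family2 k) h1 ((t : ZMod (4 * k)), true))
  have hall : ∀ z, (family2 k).Joined {j | j ≠ 2} (0, false) z := by
    rintro ⟨i, s⟩
    have hi := key i.val
    rw [ZMod.natCast_zmod_val] at hi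
    cases s
    · exact hi
    · exact hi.trans (joined_adj h0 _)
  exact (hall x).symm.trans (hall y)

theorem opposite_add_opposite :
    ((2 * k : ℕ) : ZMod (4 * k)) + ((2 * k : ℕ) : ZMod (4 * k)) = 0 := by
  rw [← Nat.cast_add, show 2 * k + 2 * k = 4 * k by ring, ZMod.natCast_self]

theorem neg_opposite : -((2 * k : ℕ) : ZMod (4 * k)) = ((2 * k : ℕ) : ZMod (4 * k)) :=
  neg_eq_of_add_eq_zero_left opposite_add_opposite

theorem isPremaniplex_family2 (hk : 0 < k) : (family2 k).IsPremaniplex where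
  nonempty := ⟨(0, false)⟩
  connected x y := (joined_family2 hk x y).mono fun _ _ => Set.mem_univ _
  closed i j hij := by
    rintro ⟨a, s⟩
    fin_cases i <;> fin_cases j <;> simp at hij <;>
      simp only [family2, Bool.not_not, add_assoc, opposite_add_opposite, add_zero]

theorem sub_opposite (i : ZMod (4 * k)) :
    i - ((2 * k : ℕ) : ZMod (4 * k)) = i + ((2 * k : ℕ) : ZMod (4 * k)) := by
  rw [sub_eq_add_neg, neg_opposite]

/-- The symmetries of the `4k`-gon underlying the family 2 premaniplex are rotations and
reflections. -/
theorem family2_dihedral (hk : 0 < k) {f : (family2 k).Flag → (family2 k).Flag}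
    (hf : ∀ c x, c ≠ 2 → f ((family2 k).adj c x) = (family2 k).adj c (f x)) :
    ∃ j : ZMod (4 * k), (∀ i s, f (i, s) = (i + j, s)) ∨ (∀ i s, f (i, s) = (j - i, !s)) := by
  have key : ∀ g : (family2 k).Flag → (family2 k).Flag,
      (∀ c x, c ≠ 2 → g ((family2 k).adj c x) = (family2 k).adj c (g x)) →
      f (0, false) = g (0, false) → ∀ x, f x = g x := by
    intro g hg h0 x
    refine (joined_family2 hk (0, false) x).induction (p := fun x => f x = g x) h0 ?_
    intro c hc z hz
    rw [hf c z hc, hg c z hc, hz]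
  obtain ⟨j, s, hjs⟩ : ∃ j s, f (0, false) = (j, s) := ⟨_, _, rfl⟩
  refine ⟨j, ?_⟩
  cases s
  · left
    refine fun i s => key (fun x => (x.1 + j, x.2)) ?_ (hjs.trans (Prod.ext (zero_add j).symm rfl)) (i, s)
    rintro c ⟨a, s⟩ hc
    fin_cases c <;> cases s <;> simp [family2] at hc ⊢ <;> ring
  · right
    refine fun i s => key (fun x => (j - x.1, !x.2)) ?_ (hjs.trans (Prod.ext (sub_zero j).symm rfl)) (i, s)
    rintro c ⟨a, s⟩ hc
    fin_cases c <;> cases s <;> simp [family2] at hc ⊢ <;> ring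

/-- Colour 2 is the central half turn of the 4k-gon followed by r_0, so rotations and reflections
respect it too. -/
theorem family2_dihedral_adj {f : (family2 k).Flag → (family2 k).Flag} {j : ZMod (4 * k)}
    (hf : (∀ i s, f (i, s) = (i + j, s)) ∨ (∀ i s, f (i, s) = (j - i, !s)))
    (c : Fin 3) (x : (family2 k).Flag) : f ((family2 k).adj c x) = (family2 k).adj c (f x) := by
  obtain ⟨a, s⟩ := x
  rcases hf with hf | hf
  · fin_cases c <;> cases s <;> simp [family2, hf] <;> ring
  · fin_cases c <;> cases s <;> simp only [family2, hf] <;> refine Prod.ext ?_ rfl <;>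
      first
      | rfl
      | exact (sub_sub _ _ _).symm
      | exact (sub_add _ _ _).symm
      | exact (sub_add_eq_sub_sub _ _ _).trans (sub_opposite _)

variable {Γ : Type v} [Group Γ] (hk : 0 < k) {τ : Fin (2 * k) → Γ}

theorem edgeVoltage_cases (i : ZMod (4 * k)) : ∃ a : Fin (2 * k),
    (i = ((a : ℕ) : ZMod (4 * k)) ∧ edgeVoltage k hk τ i = τ a) ∨
    (i = ((a : ℕ) : ZMod (4 * k)) + ((2 * k : ℕ) : ZMod (4 * k)) ∧
      edgeVoltage k hk τ i = (τ a)⁻¹) := by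
  have : NeZero (4 * k) := ⟨by omega⟩
  have hi := ZMod.val_lt i
  by_cases h : i.val < 2 * k
  · refine ⟨⟨i.val, h⟩, Or.inl ?_⟩
    have h1 : i = ((i.val : ℕ) : ZMod (4 * k)) := (ZMod.natCast_zmod_val i).symm
    refine ⟨h1, ?_⟩
    conv_lhs => rw [h1]
    exact edgeVoltage_natCast hk τ h
  · have h' : i.val - 2 * k < 2 * k := by omega
    refine ⟨⟨i.val - 2 * k, h'⟩, Or.inr ?_⟩
    have h1 : i = ((i.val - 2 * k : ℕ) : ZMod (4 * k)) + ((2 * k : ℕ) : ZMod (4 * k)) := by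
      rw [← Nat.cast_add, Nat.sub_add_cancel (by omega), ZMod.natCast_zmod_val]
    refine ⟨h1, ?_⟩
    conv_lhs => rw [h1]
    rw [edgeVoltage_opposite, edgeVoltage_natCast hk τ h']

theorem edgeVoltage_fin (a : Fin (2 * k)) :
    edgeVoltage k hk τ ((a : ℕ) : ZMod (4 * k)) = τ a := edgeVoltage_natCast hk τ a.2

namespace IsPetrieSimpleChiral

variable {hk} (h : IsPetrieSimpleChiral k hk τ)
include h

theorem edgeVoltage_ne_one (i : ZMod (4 * k)) : edgeVoltage k hk τ i ≠ 1 := by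
  obtain ⟨a, ⟨_, ha⟩ | ⟨_, ha⟩⟩ := edgeVoltage_cases hk (τ := τ) i <;> rw [ha]
  · exact h.ne_one a
  · exact inv_ne_one.2 (h.ne_one a)

theorem closure_edgeVoltage : Subgroup.closure (Set.range (edgeVoltage k hk τ)) = ⊤ := by
  rw [eq_top_iff, ← h.closure, Subgroup.closure_le]
  rintro _ ⟨a, rfl⟩
  exact Subgroup.subset_closure ⟨_, edgeVoltage_fin hk a⟩

theorem voltage_induction {p : Γ → Prop} (h1 : p 1)
    (hmul : ∀ i γ, p γ → p (edgeVoltage k hk τ i * γ)) (γ : Γ) : p γ := by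
  have hγ : γ ∈ Subgroup.closure (Set.range (edgeVoltage k hk τ)) := by
    rw [h.closure_edgeVoltage]; trivial
  induction hγ using Subgroup.closure_induction_left with
  | one => exact h1
  | mul_left x hx y _ ih =>
    obtain ⟨i, rfl⟩ := hx
    exact hmul i y ih
  | inv_mul_cancel x hx y _ ih =>
    obtain ⟨i, rfl⟩ := hx
    rw [← edgeVoltage_opposite]
    exact hmul _ y ih

theorem eq_zero_or_opposite {i : ZMod (4 * k)}
    (hi : edgeVoltage k hk τ i * edgeVoltage k hk τ i ≠ 1) :
    i = 0 ∨ i = ((2 * k : ℕ) : ZMod (4 * k)) := by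
  obtain ⟨a, ⟨hia, ha⟩ | ⟨hia, ha⟩⟩ := edgeVoltage_cases hk (τ := τ) i <;> rw [ha] at hi <;>
    rcases Nat.eq_zero_or_pos (a : ℕ) with h0 | h0
  · left; rw [hia, h0, Nat.cast_zero]
  · exact absurd (h.sq_eq_one a h0) hi
  · right; rw [hia, h0, Nat.cast_zero, zero_add]
  · rw [← mul_inv_rev, h.sq_eq_one a h0, inv_one] at hi
    exact absurd rfl hi

/-- A symmetry of the `4k`-gon that is compatible with the voltages is trivial. -/
theorem dihedral_trivial {ψ : Γ → Γ} (hinj : Function.Injective ψ) (hone : ψ 1 = 1)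
    {e : ZMod (4 * k) → ZMod (4 * k)}
    (hψ : ∀ i γ, ψ (edgeVoltage k hk τ i * γ) = edgeVoltage k hk τ (e i) * ψ γ)
    (hk2 : 2 ≤ k) {j : ZMod (4 * k)} :
    ((∀ i, e i = i + j) → j = 0) ∧ ¬ ∀ i, e i = j - i := by
  have hmul : ∀ g γ, ψ (g * γ) = ψ g * ψ γ := by
    refine h.voltage_induction (fun γ => by rw [one_mul, hone, one_mul]) ?_
    intro i g ih γ
    rw [mul_assoc, hψ, ih, hψ, mul_assoc]
  have hV : ∀ i, ψ (edgeVoltage k hk τ i) = edgeVoltage k hk τ (e i) := by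
    intro i
    rw [← mul_one (edgeVoltage k hk τ i), hψ, hone, mul_one]
  have hV0 : edgeVoltage k hk τ 0 = τ ⟨0, by omega⟩ := by
    rw [← edgeVoltage_fin hk (τ := τ)]; simp
  -- The voltage at e_0 has nontrivial square and ψ is an injective homomorphism, so the voltage at
  -- the image edge also has nontrivial square.
  have he0 : e 0 = 0 ∨ e 0 = ((2 * k : ℕ) : ZMod (4 * k)) := by
    refine h.eq_zero_or_opposite ?_
    rw [← hV, ← hmul, ← hone]
    refine hinj.ne ?_
    rw [hV0]
    exact h.sq_ne_one _
  constructor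
  · intro he
    rw [he, zero_add] at he0
    rcases he0 with hj | hj
    · exact hj
    · exfalso
      refine h.not_reflexible ⟨⟨⟨ψ, hone⟩, hmul⟩, fun a => ?_⟩
      show ψ (τ a) = _
      rw [← edgeVoltage_fin hk (τ := τ), hV, he, hj, edgeVoltage_opposite]
  · intro he
    have hj : e 0 = j := by rw [he, sub_zero]
    rw [hj] at he0
    have hlast : edgeVoltage k hk τ (((2 * k : ℕ) : ZMod (4 * k)) - 1) = τ ⟨2 * k - 1, by omega⟩ := by
      rw [← edgeVoltage_fin hk (τ := τ), Nat.cast_sub (by omega), Nat.cast_one]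
    have hinv : (τ ⟨2 * k - 1, by omega⟩)⁻¹ = τ ⟨2 * k - 1, by omega⟩ :=
      inv_eq_of_mul_eq_one_left (h.sq_eq_one _ (by simp only; omega))
    have hV1 : edgeVoltage k hk τ 1 = τ ⟨1, by omega⟩ := by
      rw [← edgeVoltage_fin hk (τ := τ)]; simp
    have hfl := h.first_last (by omega)
    -- A reflection fixing or exchanging e_0 and e_{2k} sends τ_1 to τ_1^{±1} and τ_2 to τ_{2k}, so
    -- (τ_1τ_2)² maps to 1.
    refine h.first_second (by omega) (hinj ?_)
    rw [hmul, hmul, ← hV0, ← hV1, hV, hV, he 0, he 1, sub_zero, hone]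
    rcases he0 with rfl | rfl
    · have hneg : edgeVoltage k hk τ (0 - 1) = τ ⟨2 * k - 1, by omega⟩ := by
        rw [show (0 - 1 : ZMod (4 * k)) = ((2 * k : ℕ) : ZMod (4 * k)) - 1 +
          ((2 * k : ℕ) : ZMod (4 * k)) by rw [sub_add_eq_add_sub, opposite_add_opposite],
          edgeVoltage_opposite, hlast, hinv]
      rw [hneg, hV0, hfl]
    · rw [hlast, ← zero_add ((2 * k : ℕ) : ZMod (4 * k)), edgeVoltage_opposite, hV0]
      set a := τ ⟨0, by omega⟩
      set s := τ ⟨2 * k - 1, by omega⟩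
      have h1 : s * a * s = a⁻¹ := by
        rw [eq_inv_iff_mul_eq_one]
        have := congrArg (fun g => a⁻¹ * g * a) hfl
        simpa [mul_assoc] using this
      have h2 : s * (a⁻¹ * s) = a := by
        have := congrArg (·⁻¹) h1
        simpa [hinv] using this
      rw [mul_assoc, h2, inv_mul_cancel]

end IsPetrieSimpleChiral

end Family2

/-! ### Right translations of a derived graph -/

section Derived

variable {n : ℕ} {X : FlagGraph.{u} n} {Γ : Type v} [Group Γ] (ξ : VoltageAssignment X Γ)

/-- The automorphism of the derived graph induced by a right translation. -/
def rightTranslation (α : Γ) : Equiv.Perm ξ.derived.Flag :=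
  (Equiv.refl X.Flag).prodCongr (Equiv.mulRight α)

theorem rightTranslation_mem (α : Γ) : rightTranslation ξ α ∈ ξ.derived.Aut := fun i x =>
  Prod.ext rfl (mul_assoc (ξ.volt i x.1) x.2 α)

theorem image_face {G : FlagGraph.{u} n} {σ : Equiv.Perm G.Flag} (hσ : σ ∈ G.Aut) (i : Fin n)
    (x : G.Flag) : σ '' G.face i x = G.face i (σ x) := by
  have key : ∀ ρ ∈ G.Aut, ∀ x y, G.Joined {j | j ≠ i} x y →
      G.Joined {j | j ≠ i} (ρ x) (ρ y) := by
    intro ρ hρ x y hxy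
    refine hxy.induction (p := fun y => G.Joined {j | j ≠ i} (ρ x) (ρ y))
      Relation.ReflTransGen.refl ?_
    intro j hj z hz
    rw [hρ j z]
    exact hz.trans (joined_adj hj _)
  ext y
  constructor
  · rintro ⟨z, hz, rfl⟩
    exact key σ hσ x z hz
  · intro hy
    refine ⟨σ⁻¹ y, ?_, σ.apply_symm_apply y⟩
    have := key σ⁻¹ (inv_mem hσ) _ _ hy
    rwa [show σ⁻¹ (σ x) = x from σ.symm_apply_apply x] at this

theorem isFaceTransitive_derived (i : Fin n)
    (hi : ∀ p : ξ.derived.Flag, ∀ x : X.Flag, ∃ γ, ξ.derived.Joined {j | j ≠ i} p (x, γ)) :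
    ξ.derived.IsFaceTransitive i := by
  intro p q
  obtain ⟨γ, hγ⟩ := hi p q.1
  refine ⟨_, rightTranslation_mem ξ (γ⁻¹ * q.2), ?_⟩
  rw [face_eq_face_iff.2 hγ]
  exact (image_face (rightTranslation_mem ξ _) i _).trans
    (congrArg _ (Prod.ext rfl (mul_inv_cancel_left γ q.2)))

/-- If the automorphisms of a derived graph preserve the fibres, its symmetry type graph is the
base graph. -/
theorem nonempty_iso_symmetryTypeGraph
    (h : ∀ σ ∈ ξ.derived.Aut, ∀ p : ξ.derived.Flag, (σ p).1 = p.1) :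
    Nonempty (Iso ξ.derived.symmetryTypeGraph X) := by
  let f : ξ.derived.symmetryTypeGraph.Flag → X.Flag :=
    Quotient.lift (fun p : ξ.derived.Flag => p.1) (by
      rintro a b ⟨σ, hσ⟩
      rw [← hσ]
      exact h σ σ.2 b)
  have hf : Function.Bijective f := by
    constructor
    · intro a b
      induction a using Quotient.inductionOn with | h a => ?_
      induction b using Quotient.inductionOn with | h b => ?_
      intro hab
      -- Right translations are transitive on each fibre, so the orbits are exactly the fibres.
      refine Quotient.sound ⟨⟨_, rightTranslation_mem ξ (b.2⁻¹ * a.2)⟩, ?_⟩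
      exact Prod.ext (Eq.symm hab) (mul_inv_cancel_left b.2 a.2)
    · intro x
      exact ⟨Quotient.mk _ (x, 1), rfl⟩
  refine ⟨⟨Equiv.ofBijective f hf, fun i a => ?_⟩⟩
  induction a using Quotient.inductionOn with | h a => rfl

end Derived

/-! ### Facets and vertices of the derived graph -/

section Polyhedron

variable {k : ℕ} {Γ : Type v} [Group Γ] {hk : 0 < k} {τ : Fin (2 * k) → Γ}

theorem derived_adj_of_ne {c : Fin 3} (hc : c ≠ 2) (p : (family2Voltage k hk τ).derived.Flag) :
    (family2Voltage k hk τ).derived.adj c p = ((family2 k).adj c p.1, p.2) := by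
  refine Prod.ext rfl ?_
  show (if c = 2 then _ else 1) * p.2 = p.2
  rw [if_neg hc, one_mul]

theorem derived_adj_two (p : (family2Voltage k hk τ).derived.Flag) :
    (family2Voltage k hk τ).derived.adj 2 p =
      ((family2 k).adj 2 p.1, edgeVoltage k hk τ p.1.1 * p.2) := rfl

theorem joined_of_adj_eq {n : ℕ} {G : FlagGraph.{u} n} {S : Set (Fin n)} {i : Fin n} (hi : i ∈ S)
    {x y : G.Flag} (h : G.adj i x = y) : G.Joined S x y :=
  h ▸ joined_adj hi x

theorem snd_eq_of_joined {p q : (family2Voltage k hk τ).derived.Flag}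
    (h : (family2Voltage k hk τ).derived.Joined {j | j ≠ 2} p q) : q.2 = p.2 := by
  refine h.induction (p := fun q => q.2 = p.2) rfl ?_
  intro i hi z hz
  rw [derived_adj_of_ne hi, ← hz]

theorem joined_derived_facet (x y : (family2 k).Flag) (γ : Γ) :
    (family2Voltage k hk τ).derived.Joined {j | j ≠ 2} (x, γ) (y, γ) := by
  refine (joined_family2 hk x y).induction
    (p := fun y => (family2Voltage k hk τ).derived.Joined {j | j ≠ 2} (x, γ) (y, γ))
    Relation.ReflTransGen.refl ?_
  intro i hi z hz
  exact hz.trans (joined_of_adj_eq hi (derived_adj_of_ne hi _))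

/-- The flag `p` is reached after crossing `t` edges in a walk around a vertex that starts in the
facet `γ`. -/
def OnTurn (k : ℕ) (hk : 0 < k) (τ : Fin (2 * k) → Γ) (γ : Γ) (t : ℕ)
    (p : (family2Voltage k hk τ).derived.Flag) : Prop :=
  p.2 = turn k hk τ t * γ ∧
    (p.1 = (((t * (2 * k + 1) : ℕ) : ZMod (4 * k)), false) ∨
      p.1 = (((t * (2 * k + 1) : ℕ) : ZMod (4 * k)) - 1, true))

/-- Finiteness of Γ makes the walk around a vertex close up, so it can also be followed backwards
while being indexed by natural numbers. -/
theorem exists_period [Finite Γ] (hk : 0 < k) (τ : Fin (2 * k) → Γ) :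
    ∃ m, 0 < m ∧ ∀ t, turn k hk τ (t + 4 * k * m) = turn k hk τ t := by
  have h : ∀ m t, turn k hk τ (t + 4 * k * m) = turn k hk τ t * turn k hk τ (4 * k) ^ m := by
    intro m
    induction m with
    | zero => simp
    | succ m ih =>
      intro t
      rw [mul_add, mul_one, ← add_assoc, turn_add_period, ih, mul_assoc, ← pow_succ]
  refine ⟨orderOf (turn k hk τ (4 * k)), orderOf_pos _, fun t => ?_⟩
  rw [h, pow_orderOf_eq_one, mul_one]

theorem turn_position_add_period (t m : ℕ) :
    (((t + 4 * k * m) * (2 * k + 1) : ℕ) : ZMod (4 * k)) =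
      ((t * (2 * k + 1) : ℕ) : ZMod (4 * k)) := by
  have h0 : ((4 * k : ℕ) : ZMod (4 * k)) = 0 := ZMod.natCast_self _
  rw [add_mul, Nat.cast_add, mul_assoc (4 * k), Nat.cast_mul (4 * k), h0, zero_mul, add_zero]

theorem turn_position_succ (t : ℕ) :
    (((t + 1) * (2 * k + 1) : ℕ) : ZMod (4 * k)) =
      ((t * (2 * k + 1) : ℕ) : ZMod (4 * k)) + ((2 * k : ℕ) : ZMod (4 * k)) + 1 := by
  push_cast
  ring

theorem OnTurn.exists_succ [Finite Γ] {γ : Γ} {t : ℕ}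
    {p : (family2Voltage k hk τ).derived.Flag} (h : OnTurn k hk τ γ t p) :
    ∃ s, OnTurn k hk τ γ (s + 1) p := by
  obtain ⟨m, hm, hper⟩ := exists_period hk τ
  have hpos : 0 < 4 * k * m := by positivity
  refine ⟨t + 4 * k * m - 1, ?_⟩
  rw [Nat.sub_add_cancel (by omega)]
  rw [OnTurn, hper, turn_position_add_period]
  exact h

theorem OnTurn.adj [Finite Γ] {γ : Γ} {t : ℕ} {p : (family2Voltage k hk τ).derived.Flag}
    (h : OnTurn k hk τ γ t p) {c : Fin 3} (hc : c ≠ 0) :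
    ∃ s, OnTurn k hk τ γ s ((family2Voltage k hk τ).derived.adj c p) := by
  obtain ⟨t, h⟩ := h.exists_succ
  obtain ⟨hδ, hx⟩ := h
  have hc12 : c = 1 ∨ c = 2 := by fin_cases c <;> simp at hc ⊢
  rcases hc12 with rfl | rfl
  · rw [derived_adj_of_ne (by decide)]
    refine ⟨t + 1, hδ, ?_⟩
    rcases hx with hx | hx
    · right; exact congrArg ((family2 k).adj 1) hx
    · left; exact (congrArg ((family2 k).adj 1) hx).trans (Prod.ext (sub_add_cancel _ _) rfl)
  · rw [derived_adj_two]
    rcases hx with hx | hx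
    · refine ⟨t + 1 + 1, ?_, Or.inr ((congrArg ((family2 k).adj 2) hx).trans (Prod.ext ?_ rfl))⟩
      · show edgeVoltage k hk τ p.1.1 * p.2 = _
        rw [hδ, hx, ← mul_assoc]
        rfl
      · rw [turn_position_succ (t + 1), add_sub_cancel_right]
        rfl
    · have hpos : (((t + 1) * (2 * k + 1) : ℕ) : ZMod (4 * k)) - 1 =
          ((t * (2 * k + 1) : ℕ) : ZMod (4 * k)) + ((2 * k : ℕ) : ZMod (4 * k)) := by
        rw [turn_position_succ, add_sub_cancel_right]
      refine ⟨t, ?_, Or.inl ((congrArg ((family2 k).adj 2) hx).trans (Prod.ext ?_ rfl))⟩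
      · show edgeVoltage k hk τ p.1.1 * p.2 = _
        rw [hδ, hx]
        show edgeVoltage k hk τ ((((t + 1) * (2 * k + 1) : ℕ) : ZMod (4 * k)) - 1) * _ = _
        rw [hpos, edgeVoltage_opposite, turn, mul_assoc, inv_mul_cancel_left]
      · show (((t + 1) * (2 * k + 1) : ℕ) : ZMod (4 * k)) - 1 + ((2 * k : ℕ) : ZMod (4 * k)) = _
        rw [hpos, add_assoc, opposite_add_opposite, add_zero]

theorem OnTurn.of_joined [Finite Γ] {γ : Γ} {t : ℕ}
    {p q : (family2Voltage k hk τ).derived.Flag} (h : OnTurn k hk τ γ t p)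
    (hpq : (family2Voltage k hk τ).derived.Joined {j | j ≠ 0} p q) :
    ∃ s, OnTurn k hk τ γ s q := by
  refine hpq.induction (p := fun q => ∃ s, OnTurn k hk τ γ s q) ⟨t, h⟩ ?_
  rintro c hc z ⟨s, hs⟩
  exact hs.adj hc

theorem exists_turn_position (hk : 0 < k) (i : ZMod (4 * k)) :
    ∃ t : ℕ, ((t * (2 * k + 1) : ℕ) : ZMod (4 * k)) = i := by
  have : NeZero (4 * k) := ⟨by omega⟩
  -- The factor 2k + 1 is its own inverse modulo 4k: (2k + 1)² = 4k(k + 1) + 1.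
  refine ⟨i.val * (2 * k + 1), ?_⟩
  have h0 : ((4 * k : ℕ) : ZMod (4 * k)) = 0 := ZMod.natCast_self _
  rw [show i.val * (2 * k + 1) * (2 * k + 1) = 4 * k * (i.val * (k + 1)) + i.val by ring,
    Nat.cast_add, Nat.cast_mul, h0, zero_mul, zero_add, ZMod.natCast_zmod_val]

theorem exists_onTurn (p : (family2Voltage k hk τ).derived.Flag) :
    ∃ γ t, OnTurn k hk τ γ t p := by
  obtain ⟨⟨i, s⟩, δ⟩ := p
  cases s
  · obtain ⟨t, ht⟩ := exists_turn_position hk i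
    exact ⟨(turn k hk τ t)⁻¹ * δ, t, (mul_inv_cancel_left _ _).symm, Or.inl (by rw [ht])⟩
  · obtain ⟨t, ht⟩ := exists_turn_position hk (i + 1)
    refine ⟨(turn k hk τ t)⁻¹ * δ, t, (mul_inv_cancel_left _ _).symm, Or.inr ?_⟩
    rw [ht, add_sub_cancel_right]

/-- Every vertex of the derived graph meets every fibre. -/
theorem joined_derived_vertex (p : (family2Voltage k hk τ).derived.Flag) (x : (family2 k).Flag) :
    ∃ γ, (family2Voltage k hk τ).derived.Joined {j | j ≠ 0} p (x, γ) := by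
  have h1 : (1 : Fin 3) ∈ {j : Fin 3 | j ≠ 0} := by simp
  have h2 : (2 : Fin 3) ∈ {j : Fin 3 | j ≠ 0} := by simp
  have hleft : ∀ p : (family2Voltage k hk τ).derived.Flag, ∃ t : ℕ, ∃ γ,
      (family2Voltage k hk τ).derived.Joined {j | j ≠ 0}
        ((((t * (2 * k + 1) : ℕ) : ZMod (4 * k)), false), γ) p := by
    intro p
    obtain ⟨γ, t, hδ, hp⟩ := exists_onTurn p
    obtain ⟨y, δ⟩ := p
    refine ⟨t, δ, ?_⟩
    rcases hp with rfl | rfl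
    · exact Relation.ReflTransGen.refl
    · exact joined_of_adj_eq h1 (derived_adj_of_ne (by decide) _)
  have hzero : ∀ (t : ℕ) (γ : Γ), ∃ δ, (family2Voltage k hk τ).derived.Joined {j | j ≠ 0}
      ((0, false), δ) ((((t * (2 * k + 1) : ℕ) : ZMod (4 * k)), false), γ) := by
    intro t
    induction t with
    | zero =>
      intro γ
      refine ⟨γ, ?_⟩
      rw [Nat.zero_mul, Nat.cast_zero]
      exact Relation.ReflTransGen.refl
    | succ t ih =>
      intro γ
      obtain ⟨δ, hδ⟩ := ih ((edgeVoltage k hk τ ((t * (2 * k + 1) : ℕ) : ZMod (4 * k)))⁻¹ * γ)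
      refine ⟨δ, (hδ.trans (joined_of_adj_eq h2 (derived_adj_two _))).trans
        (joined_of_adj_eq h1 ((derived_adj_of_ne (by decide) _).trans ?_))⟩
      exact Prod.ext (Prod.ext (turn_position_succ t).symm rfl) (mul_inv_cancel_left _ γ)
  have hbase : ∀ p : (family2Voltage k hk τ).derived.Flag, ∃ γ,
      (family2Voltage k hk τ).derived.Joined {j | j ≠ 0} ((0, false), γ) p := by
    intro p
    obtain ⟨t, γ, h⟩ := hleft p
    obtain ⟨δ, hδ⟩ := hzero t γ
    exact ⟨δ, hδ.trans h⟩
  -- A path around a vertex from the fibre of (0, false) to that of x is moved by a right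
  -- translation to the vertex of p.
  obtain ⟨γ, hγ⟩ := hbase (x, 1)
  obtain ⟨δ, hδ⟩ := hbase p
  have hmap : ∀ q, (family2Voltage k hk τ).derived.Joined {j | j ≠ 0} ((0, false), γ) q →
      (family2Voltage k hk τ).derived.Joined {j | j ≠ 0} ((0, false), δ)
        (q.1, q.2 * (γ⁻¹ * δ)) := by
    intro q hq
    have := image_face (rightTranslation_mem (family2Voltage k hk τ) (γ⁻¹ * δ)) 0 ((0, false), γ)
    have hmem : rightTranslation (family2Voltage k hk τ) (γ⁻¹ * δ) q ∈
        (family2Voltage k hk τ).derived.face 0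
          (rightTranslation (family2Voltage k hk τ) (γ⁻¹ * δ) ((0, false), γ)) := by
      rw [← this]
      exact ⟨q, hq, rfl⟩
    have he : rightTranslation (family2Voltage k hk τ) (γ⁻¹ * δ) ((0, false), γ) =
        ((0, false), δ) := Prod.ext rfl (mul_inv_cancel_left γ δ)
    rw [he] at hmem
    exact hmem
  exact ⟨_, hδ.symm.trans (hmap _ hγ)⟩

namespace IsPetrieSimpleChiral

variable (h : IsPetrieSimpleChiral k hk τ)
include h

/-- The intersection of a facet with a vertex consists of at most two flags. -/
theorem facet_inter_vertex [Finite Γ] {p q : (family2Voltage k hk τ).derived.Flag}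
    (h2 : (family2Voltage k hk τ).derived.Joined {j | j ≠ 2} p q)
    (h0 : (family2Voltage k hk τ).derived.Joined {j | j ≠ 0} p q) :
    q = p ∨ q = (family2Voltage k hk τ).derived.adj 1 p := by
  obtain ⟨γ, t, ht⟩ := exists_onTurn p
  obtain ⟨s, hs⟩ := ht.of_joined h0
  have hpq := snd_eq_of_joined h2
  -- A common facet means equal turns, so injectivity modulo 4k gives the same position on the
  -- 4k-gon.
  have hst : turn k hk τ s = turn k hk τ t := by
    have := hs.1.symm.trans (hpq.trans ht.1)
    exact mul_right_cancel this
  have hpos : ((s * (2 * k + 1) : ℕ) : ZMod (4 * k)) = ((t * (2 * k + 1) : ℕ) : ZMod (4 * k)) := by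
    rw [Nat.cast_mul, Nat.cast_mul, h.turn_injective s t hst]
  have hs2 := hs.2
  have ht2 := ht.2
  rw [hpos] at hs2
  rw [derived_adj_of_ne (by decide)]
  rcases ht2 with ht2 | ht2 <;> rcases hs2 with hs2 | hs2
  · exact Or.inl (Prod.ext (hs2.trans ht2.symm) hpq)
  · exact Or.inr (Prod.ext (hs2.trans (congrArg ((family2 k).adj 1) ht2).symm) hpq)
  · have hadj : (family2 k).adj 1 (((t * (2 * k + 1) : ℕ) : ZMod (4 * k)) - 1, true) =
        (((t * (2 * k + 1) : ℕ) : ZMod (4 * k)), false) := Prod.ext (sub_add_cancel _ _) rfl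
    exact Or.inr (Prod.ext (hs2.trans ((congrArg ((family2 k).adj 1) ht2).trans hadj).symm) hpq)
  · exact Or.inl (Prod.ext (hs2.trans ht2.symm) hpq)

end IsPetrieSimpleChiral

end Polyhedron

/-! ### The derived graph as a polyhedron, and its automorphisms -/

theorem family2_adj_snd_ne {k : ℕ} (c : Fin 3) (x : (family2 k).Flag) : ((family2 k).adj c x).2 ≠ x.2 := by
  obtain ⟨i, s⟩ := x
  fin_cases c <;> cases s <;> simp [family2]

theorem family2_adj_zero_ne_adj_one {k : ℕ} (hk : 0 < k) (x : (family2 k).Flag) :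
    (family2 k).adj 0 x ≠ (family2 k).adj 1 x := by
  have : Fact (1 < 4 * k) := ⟨by omega⟩
  obtain ⟨i, s⟩ := x
  intro h
  have h1 := congrArg Prod.fst h
  cases s
  · have h2 : i = i - 1 := h1
    exact one_ne_zero (sub_eq_self.1 h2.symm)
  · have h2 : i = i + 1 := h1
    exact one_ne_zero (left_eq_add.1 h2)

namespace IsPetrieSimpleChiral

variable {k : ℕ} {Γ : Type v} [Group Γ] {hk : 0 < k} {τ : Fin (2 * k) → Γ}

variable (h : IsPetrieSimpleChiral k hk τ)
include h

theorem parallel (i j : Fin 3) (x : (family2 k).Flag) (hij : i ≠ j)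
    (hadj : (family2 k).adj i x = (family2 k).adj j x) :
    (family2Voltage k hk τ).volt i x ≠ (family2Voltage k hk τ).volt j x := by
  have h2 : (family2Voltage k hk τ).volt 2 x = edgeVoltage k hk τ x.1 := rfl
  have h01 : ∀ c : Fin 3, c ≠ 2 → (family2Voltage k hk τ).volt c x = 1 := fun c hc => if_neg hc
  have hne := h.edgeVoltage_ne_one x.1
  by_cases hi : i = 2
  · subst hi
    rw [h2, h01 j hij.symm]
    exact hne
  · by_cases hj : j = 2
    · subst hj
      rw [h2, h01 i hij]
      exact hne.symm
    · exfalso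
      have h' := family2_adj_zero_ne_adj_one hk x
      fin_cases i <;> fin_cases j <;> simp_all

theorem isVoltagePremaniplex : (family2Voltage k hk τ).IsVoltagePremaniplex where
  premaniplex := isPremaniplex_family2 hk
  spanning_tree := by
    let S : SimpleGraph (family2 k).Flag :=
      { Adj := fun x y => ∃ c, c ≠ 2 ∧ (family2 k).adj c x = y
        symm := ⟨by
          rintro x _ ⟨c, hc, rfl⟩
          exact ⟨c, hc, (family2 k).adj_adj c x⟩⟩
        loopless := ⟨by
          rintro x ⟨c, _, hx⟩
          exact family2_adj_snd_ne c x (congrArg Prod.snd hx)⟩ }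
    have hS : S.Connected := by
      have : Nonempty (family2 k).Flag := ⟨(0, false)⟩
      refine SimpleGraph.Connected.mk fun x y => ?_
      refine (joined_family2 hk x y).induction (p := fun y => S.Reachable x y)
        (SimpleGraph.Reachable.refl x) ?_
      intro c hc z hz
      have hadj : S.Adj z ((family2 k).adj c z) := ⟨c, hc, rfl⟩
      exact hz.trans hadj.reachable
    obtain ⟨T, hT, htree⟩ := hS.exists_isTree_le
    refine ⟨T, htree, fun x y hxy => ?_⟩
    obtain ⟨c, hc, hadj⟩ := hT hxy
    exact ⟨c, hadj, if_neg hc⟩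
  generate := by
    rw [eq_top_iff, ← h.closure_edgeVoltage]
    refine Subgroup.closure_mono ?_
    rintro _ ⟨i, rfl⟩
    exact ⟨2, (i, false), rfl⟩
  semiedge c x hx := absurd (congrArg Prod.snd hx) (family2_adj_snd_ne c x)
  parallel := h.parallel
  closed i j hij := by
    rintro ⟨a, s⟩
    have hV := edgeVoltage_opposite k hk τ a
    fin_cases i <;> fin_cases j <;> simp at hij <;>
      simp [family2Voltage, family2] <;> simp at hV <;> rw [hV] <;> simp

theorem isPremaniplex_derived : (family2Voltage k hk τ).derived.IsPremaniplex where
  nonempty := ⟨((0, false), 1)⟩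
  connected := by
    have key : ∀ (x : (family2 k).Flag) (γ : Γ),
        (family2Voltage k hk τ).derived.Joined Set.univ ((0, false), 1) (x, γ) := by
      intro x γ
      have hfac : ∀ x y γ, (family2Voltage k hk τ).derived.Joined Set.univ (x, γ) (y, γ) :=
        fun x y γ => (joined_derived_facet x y γ).mono fun _ _ => Set.mem_univ _
      revert x
      refine h.voltage_induction (p := fun γ => ∀ x,
        (family2Voltage k hk τ).derived.Joined Set.univ ((0, false), 1) (x, γ)) ?_ ?_ γ
      · exact fun x => hfac _ _ _
      · intro i γ hγ x
        exact ((hγ (i, false)).trans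
          (joined_of_adj_eq (Set.mem_univ 2) (derived_adj_two _))).trans (hfac _ _ _)
    exact fun p q => (key p.1 p.2).symm.trans (key q.1 q.2)
  closed i j hij p := by
    refine Prod.ext ((isPremaniplex_family2 hk).closed i j hij p.1) ?_
    have := h.isVoltagePremaniplex.closed i j hij p.1
    show (family2Voltage k hk τ).volt j _ * ((family2Voltage k hk τ).volt i _ *
      ((family2Voltage k hk τ).volt j _ * ((family2Voltage k hk τ).volt i p.1 * p.2))) = p.2
    rw [← mul_assoc, ← mul_assoc, ← mul_assoc]
    exact mul_eq_right.2 this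

theorem isManiplex_derived [Finite Γ] : (family2Voltage k hk τ).derived.IsManiplex where
  toIsPremaniplex := h.isPremaniplex_derived
  finite := by
    have : NeZero (4 * k) := ⟨by omega⟩
    show Finite ((ZMod (4 * k) × Bool) × Γ)
    infer_instance
  no_semiedge c p hp := family2_adj_snd_ne c p.1 (congrArg (fun q => q.1.2) hp)
  no_parallel i j p hij hp := h.parallel i j p.1 hij (congrArg Prod.fst hp)
    (mul_right_cancel (congrArg Prod.snd hp))

/-- In rank 3 the only substantial case compares a facet with a vertex, whose common flags are p and
its 1-adjacent flag. -/
theorem isPolytope_derived [Finite Γ] : (family2Voltage k hk τ).derived.IsPolytope where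
  toIsManiplex := h.isManiplex_derived
  path_intersection a b p q hpq hpq' := by
    have hman := h.isManiplex_derived
    by_cases ha : a = 0
    · subst ha
      refine hpq.mono fun i hi => ?_
      exact ⟨Fin.zero_le i, hi⟩
    by_cases hb : b = 2
    · subst hb
      refine hpq'.mono fun i hi => ?_
      exact ⟨hi, Fin.le_last i⟩
    have h2 : (family2Voltage k hk τ).derived.Joined {j | j ≠ 2} p q := hpq.mono fun i hi => by
      simp only [Set.mem_ofPred_eq] at hi ⊢
      omega
    have h0 : (family2Voltage k hk τ).derived.Joined {j | j ≠ 0} p q := hpq'.mono fun i hi => by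
      simp only [Set.mem_ofPred_eq] at hi ⊢
      omega
    rcases h.facet_inter_vertex h2 h0 with rfl | rfl
    · exact Relation.ReflTransGen.refl
    by_cases hb0 : b = 0
    · subst hb0
      rcases hpq.eq_or_eq_adj (i := 0) (fun j hj => Fin.le_zero_iff.1 hj) with he | he
      · exact absurd he (hman.no_semiedge _ _)
      · exact absurd he (hman.no_parallel _ _ _ (by decide))
    by_cases ha2 : a = 2
    · subst ha2
      rcases hpq'.eq_or_eq_adj (i := 2) (fun j hj => Fin.last_le_iff.1 hj) with he | he
      · exact absurd he (hman.no_semiedge _ _)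
      · exact absurd he (hman.no_parallel _ _ _ (by decide))
    refine joined_adj ?_ _
    simp only [Set.mem_ofPred_eq]
    omega

/-- The automorphisms of the derived graph preserve the fibres. -/
theorem aut_fst_eq (hk2 : 2 ≤ k) {σ : Equiv.Perm (family2Voltage k hk τ).derived.Flag}
    (hσ : σ ∈ (family2Voltage k hk τ).derived.Aut) (p : (family2Voltage k hk τ).derived.Flag) :
    (σ p).1 = p.1 := by
  let ρ : Γ → (family2 k).Flag → (family2 k).Flag := fun γ x => (σ (x, γ)).1
  let φ : Γ → Γ := fun γ => (σ ((0, false), γ)).2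
  have hlow : ∀ c x γ, c ≠ 2 →
      σ ((family2 k).adj c x, γ) = ((family2 k).adj c (ρ γ x), (σ (x, γ)).2) := by
    intro c x γ hc
    have h1 := hσ c (x, γ)
    rw [derived_adj_of_ne hc (σ (x, γ))] at h1
    exact (congrArg σ (derived_adj_of_ne hc (x, γ))).symm.trans h1
  have htwo : ∀ x γ, σ ((family2 k).adj 2 x, edgeVoltage k hk τ x.1 * γ) =
      ((family2 k).adj 2 (ρ γ x), edgeVoltage k hk τ (ρ γ x).1 * (σ (x, γ)).2) :=
    fun x γ => hσ 2 (x, γ)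
  have hρlow : ∀ γ c x, c ≠ 2 → ρ γ ((family2 k).adj c x) = (family2 k).adj c (ρ γ x) :=
    fun γ c x hc => congrArg Prod.fst (hlow c x γ hc)
  have hφ : ∀ x γ, (σ (x, γ)).2 = φ γ := by
    intro x γ
    refine (joined_family2 hk (0, false) x).induction (p := fun x => (σ (x, γ)).2 = φ γ) rfl ?_
    intro c hc z hz
    exact (congrArg Prod.snd (hlow c z γ hc)).trans hz
  have hdih : ∀ γ, ∃ j : ZMod (4 * k), (∀ i s, ρ γ (i, s) = (i + j, s)) ∨
      (∀ i s, ρ γ (i, s) = (j - i, !s)) := fun γ => family2_dihedral hk (hρlow γ)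
  -- Neighbouring facets undergo the same symmetry: the two agree at one flag across the shared
  -- edge, since dihedral symmetries commute with colour 2, and colours 0 and 1 propagate this
  -- around the facet.
  have hρstep : ∀ i γ x, ρ (edgeVoltage k hk τ i * γ) x = ρ γ x := by
    intro i γ x
    obtain ⟨j, hj⟩ := hdih γ
    have hbase : ρ (edgeVoltage k hk τ i * γ) ((family2 k).adj 2 (i, false)) =
        ρ γ ((family2 k).adj 2 (i, false)) :=
      (congrArg Prod.fst (htwo (i, false) γ)).trans (family2_dihedral_adj hj 2 (i, false)).symm
    refine (joined_family2 hk ((family2 k).adj 2 (i, false)) x).induction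
      (p := fun x => ρ (edgeVoltage k hk τ i * γ) x = ρ γ x) hbase ?_
    intro c hc z hz
    rw [hρlow _ c z hc, hρlow _ c z hc, hz]
  have hρ : ∀ γ, ∀ x, ρ γ x = ρ 1 x := by
    refine h.voltage_induction (fun x => rfl) fun i γ ih x => ?_
    rw [hρstep, ih]
  have hform : ∀ x γ, σ (x, γ) = (ρ 1 x, φ γ) := fun x γ => Prod.ext (hρ γ x) (hφ x γ)
  have hφinj : Function.Injective φ := by
    intro γ δ hγδ
    have h1 : σ ((0, false), γ) = σ ((0, false), δ) :=
      (hform (0, false) γ).trans ((congrArg (Prod.mk (ρ 1 (0, false))) hγδ).trans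
        (hform (0, false) δ).symm)
    exact congrArg Prod.snd (σ.injective h1)
  have hφmul : ∀ x γ, φ (edgeVoltage k hk τ x.1 * γ) =
      edgeVoltage k hk τ (ρ 1 x).1 * φ γ := by
    intro x γ
    rw [← hφ ((family2 k).adj 2 x), htwo, hφ, hρ]
  -- Dividing by φ 1 on the right normalizes the action on facets to fix the identity without
  -- changing its equivariance.
  have htriv := fun e he j => h.dihedral_trivial (ψ := fun γ => φ γ * (φ 1)⁻¹)
    (fun γ δ hγδ => hφinj (mul_right_cancel hγδ)) (mul_inv_cancel _) (e := e) he hk2 (j := j)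
  obtain ⟨j, hj⟩ := hdih 1
  have hj0 : j = 0 ∧ ∀ i s, ρ 1 (i, s) = (i + j, s) := by
    rcases hj with hj | hj
    · refine ⟨(htriv (fun i => i + j) ?_ j).1 fun _ => rfl, hj⟩
      intro i γ
      have := hφmul (i, false) γ
      rw [hj] at this
      simp only [this, mul_assoc]
    · refine absurd (fun _ => rfl) (htriv (fun i => j - i) ?_ j).2
      intro i γ
      have := hφmul (i, false) γ
      rw [hj] at this
      simp only [this, mul_assoc]
  obtain ⟨rfl, hρ1⟩ := hj0
  have hfst : (σ p).1 = ρ 1 p.1 := hρ p.2 p.1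
  rw [hfst]
  exact (hρ1 p.1.1 p.1.2).trans (Prod.ext (add_zero _) rfl)

/-- An automorphism preserving a facet fixes the group coordinate of its flags, and it always
preserves the fibre; so it fixes a flag. -/
theorem hasTrivialFaceStabilizer (hk2 : 2 ≤ k) :
    (family2Voltage k hk τ).derived.HasTrivialFaceStabilizer 2 := by
  intro p σ hσ himg
  refine h.isPremaniplex_derived.aut_eq_one hσ (x := p) ?_
  rw [image_face hσ, face_eq_face_iff] at himg
  exact Prod.ext (h.aut_fst_eq hk2 hσ p) (snd_eq_of_joined himg).symm

end IsPetrieSimpleChiral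

end FlagGraph

theorem mainTheorem2 (k : ℕ) (hk : 2 ≤ k) (P : FlagGraph.{u} (2 * k + 1))
    (hP : P.IsPolytope) (hchiral : P.IsChiral) (hpetrie : P.HasSimplePetriePolygons)
    (Φ : P.Flag) :
    (∃! τ : Fin (2 * k) → P.RightAut, P.IsDistinguishedFamily Φ τ) ∧
    ∀ τ : Fin (2 * k) → P.RightAut, P.IsDistinguishedFamily Φ τ →
      Subgroup.closure (Set.range τ) = ⊤ ∧
      (FlagGraph.family2Voltage k (by omega) τ).IsVoltagePremaniplex ∧
      (FlagGraph.family2Voltage k (by omega) τ).derived.IsPolytope ∧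
      Nonempty (FlagGraph.Iso
        (FlagGraph.family2Voltage k (by omega) τ).derived.symmetryTypeGraph
        (FlagGraph.family2 k)) ∧
      (FlagGraph.family2Voltage k (by omega) τ).derived.IsFaceTransitive 0 ∧
      (FlagGraph.family2Voltage k (by omega) τ).derived.IsFaceTransitive 2 ∧
      (FlagGraph.family2Voltage k (by omega) τ).derived.HasTrivialFaceStabilizer 2 := by
  have hpre := hP.toIsPremaniplex
  have : Finite P.Flag := hP.finite
  have : Finite P.RightAut := hpre.finite_rightAut
  refine ⟨hchiral.existsUnique_isDistinguishedFamily hpre Φ, fun τ hτ => ?_⟩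
  have h := hτ.isPetrieSimpleChiral hk hP hchiral hpetrie
  refine ⟨h.closure, h.isVoltagePremaniplex, h.isPolytope_derived,
    FlagGraph.nonempty_iso_symmetryTypeGraph _ fun σ hσ => h.aut_fst_eq hk hσ,
    FlagGraph.isFaceTransitive_derived _ _ FlagGraph.joined_derived_vertex,
    FlagGraph.isFaceTransitive_derived _ _ fun p x =>
      ⟨p.2, FlagGraph.joined_derived_facet p.1 x p.2⟩,
    h.hasTrivialFaceStabilizer hk⟩
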